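/- Let $M$ be a connected $C^\infty$-manifold without boundary of dimension $n\ge 2$. A Lorentz–Finsler structure on $M$ is a function $L:TM\to\mathbb R$ that is $C^\infty$ on $TM\setminus\{0\}$, satisfies $L(cv)=c^2L(v)$ for all $v\in TM$ and $c>0$, and is such that for every $v\in TM\setminus\{0\}$ the matrix $g_{ij}(v)=\frac{\partial^2L}{\partial v^i\partial v^j}(v)$ (in local coordinates $(x^i)$ of $M$ and the induced fiber coordinates $(v^i)$) is non-degenerate with signature $(-,+,\dots,+)$. The pair $(M,L)$ is a Finsler spacetime if, moreover, there is a smooth vector field $X$ on $M$ with $L(X(x))<0$ for all $x\in M$. For $v\in TM\setminus\{0\}$, with $(g^{ij}(v))$ the inverse of $(g_{ij}(v))$, put $$\gamma^i_{jk}=\tfrac12\sum_l g^{il}\Bigl(\tfrac{\partial g_{lk}}{\partial x^j}+\tfrac{\partial g_{jl}}{\partial x^k}-\tfrac{\partial g_{jk}}{\partial x^l}\Bigr),\qquad G^i=\sum_{j,k}\gamma^i_{jk}v^jv^k,\qquad N^i_j=\tfrac12\tfrac{\partial G^i}{\partial v^j},$$ $$\Gamma^i_{jk}=\gamma^i_{jk}-\tfrac12\sum_{l,m}g^{il}\Bigl(\tfrac{\partial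 g_{lk}}{\partial v^m}N^m_j+\tfrac{\partial g_{jl}}{\partial v^m}N^m_k-\tfrac{\partial g_{jk}}{\partial v^m}N^m_l\Bigr);$$ the $\Gamma^i_{jk}(v)$ are the coefficients of the Chern connection of $L$. A vector field $V$ along a curve $\eta$ with nowhere vanishing velocity is $L$-parallel if $D^{\dot\eta}_{\dot\eta}V=0$, that is, $\dot V^i+\sum_{j,k}\Gamma^i_{jk}(\dot\eta)\,\dot\eta^jV^k=0$ in local coordinates. An $L$-geodesic is a $C^2$-curve $\eta$ with $D^{\dot\eta}_{\dot\eta}\dot\eta=0$, that is, $\ddot\eta^i+\sum_{j,k}\Gamma^i_{jk}(\dot\eta)\,\dot\eta^j\dot\eta^k=0$, where the sum is read as $0$ where $\dot\eta=0$. The structure $L$ is of Berwald type if $\Gamma^i_{jk}$ is constant on $T_xM\setminus\{0\}$ for every $x\in M$. **Proposition.** Let $(M,L)$ be a Finsler spacetime and let $g$ be a smooth Lorentzian metric on $M$ that is preserved by every $L$-parallel transport along nonconstant $L$-geodesics: for every nonconstant $L$-geodesic $\eta:J\to M$ on a nondegenerate interval $J\subseteq\mathbb R$ and all $L$-parallel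 vector fields $V,W$ along $\eta$, the function $t\mapsto g(V(t),W(t))$ is constant on $J$. Then: 1. $g$ and $L$ have the same geodesics: a curve $\eta:J\to M$ on a nondegenerate interval $J\subseteq\mathbb R$ is an $L$-geodesic if and only if it is a geodesic of the Levi-Civita connection of $g$. 2. The Chern connection of $L$ equals the Levi-Civita connection of $g$: in all local coordinates and for all $v\in TM\setminus\{0\}$, $\Gamma^i_{jk}(v)$ equals the Christoffel symbol of $g$ at the base point of $v$. 3. $L$ is of Berwald type. -/

import Mathlib

open scoped Manifold ContDiff Matrix Topology

noncomputable section

namespace LorentzFinsler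

/-- The model space of an `n`-dimensional manifold. -/
abbrev Coord (n : ℕ) : Type := EuclideanSpace ℝ (Fin n)

/-- The `j`-th coordinate vector. -/
def coordVec {n : ℕ} (j : Fin n) : Coord n := EuclideanSpace.single j (1 : ℝ)

/-- The partial derivative `∂f/∂z^j` at `z` of a function of `n` real variables. -/
def partialDeriv {n : ℕ} (j : Fin n) (f : Coord n → ℝ) (z : Coord n) : ℝ :=
  fderiv ℝ f z (coordVec j)

/-- A square matrix with signature `(-, +, …, +)`: it is congruent to `diag (1, …, -1, …, 1)` with
exactly one `-1`. (Such a matrix is automatically symmetric and non-degenerate.) -/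
def HasLorentzSignature {n : ℕ} (A : Matrix (Fin n) (Fin n) ℝ) : Prop :=
  ∃ (P : Matrix (Fin n) (Fin n) ℝ) (i₀ : Fin n), IsUnit P.det ∧
    Pᵀ * A * P = Matrix.diagonal (fun i => if i = i₀ then (-1 : ℝ) else 1)

/-- The Christoffel symbols `½ ∑_l A^{il} (∂_j A_{lk} + ∂_k A_{jl} - ∂_l A_{jk})` of a field of
matrices `A` on coordinate space. -/
def christoffel {n : ℕ} (A : Coord n → Matrix (Fin n) (Fin n) ℝ) (x : Coord n)
    (i j k : Fin n) : ℝ :=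
  (1 / 2) * ∑ l, (A x)⁻¹ i l *
    (partialDeriv j (fun y => A y l k) x + partialDeriv k (fun y => A y j l) x
      - partialDeriv l (fun y => A y j k) x)

section Manifold

variable {n : ℕ} {M : Type*} [TopologicalSpace M] [ChartedSpace (Coord n) M]

/-- `e` is a local coordinate system of the smooth manifold `M`. -/
def IsChart (e : OpenPartialHomeomorph M (Coord n)) : Prop :=
  e ∈ IsManifold.maximalAtlas (𝓡 n) ∞ M

/-- The tangent vector `∑ v^i ∂/∂x^i` at the point with coordinates `x` in the chart `e`. -/
def ofCoord (e : OpenPartialHomeomorph M (Coord n)) (x v : Coord n) :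
    TangentSpace (𝓡 n) (e.symm x) :=
  mfderiv (𝓡 n) (𝓡 n) e.symm x v

/-- The components, in the chart `e`, of a tangent vector `v` at the point `p`. -/
def toCoord (e : OpenPartialHomeomorph M (Coord n)) (p : M) (v : TangentSpace (𝓡 n) p) : Coord n :=
  mfderiv (𝓡 n) (𝓡 n) e p v

/-! ### Lorentz-Finsler structures -/

/-- A function on the tangent bundle, expressed in the coordinates `(x^i, v^i)` of the chart `e`. -/
def localRep (L : TangentBundle (𝓡 n) M → ℝ) (e : OpenPartialHomeomorph M (Coord n))
    (x v : Coord n) : ℝ :=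
  L ⟨e.symm x, ofCoord e x v⟩

/-- The fundamental matrix `g_{ij}(x, v) = ∂²L/∂v^i∂v^j`. -/
def fundMatrix (L : TangentBundle (𝓡 n) M → ℝ) (e : OpenPartialHomeomorph M (Coord n))
    (x v : Coord n) : Matrix (Fin n) (Fin n) ℝ :=
  Matrix.of fun i j => partialDeriv i (fun u => partialDeriv j (localRep L e x) u) v

/-- Lorentz-Finsler structures on `M`. -/
structure IsLorentzFinsler (L : TangentBundle (𝓡 n) M → ℝ) [IsManifold (𝓡 n) ∞ M] : Prop where
  smooth : ContMDiffOn (𝓡 n).tangent 𝓘(ℝ, ℝ) ∞ L {p | p.2 ≠ 0}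
  homogeneous : ∀ (x : M) (v : TangentSpace (𝓡 n) x) (c : ℝ), 0 < c →
    L ⟨x, c • v⟩ = c ^ 2 * L ⟨x, v⟩
  lorentzian : ∀ e : OpenPartialHomeomorph M (Coord n), IsChart e → ∀ x ∈ e.target,
    ∀ v : Coord n, v ≠ 0 → HasLorentzSignature (fundMatrix L e x v)

/-- `(M, L)` is a Finsler spacetime: a Lorentz-Finsler manifold with a smooth timelike
vector field. -/
structure IsFinslerSpacetime (L : TangentBundle (𝓡 n) M → ℝ) [IsManifold (𝓡 n) ∞ M] : Prop
    extends IsLorentzFinsler L where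
  timeOriented : ∃ X : (x : M) → TangentSpace (𝓡 n) x,
    ContMDiff (𝓡 n) (𝓡 n).tangent ∞ (fun x => (⟨x, X x⟩ : TangentBundle (𝓡 n) M)) ∧
    ∀ x, L ⟨x, X x⟩ < 0

/-- `γ^i_{jk}(x, v)`. -/
def formalChristoffel (L : TangentBundle (𝓡 n) M → ℝ) (e : OpenPartialHomeomorph M (Coord n))
    (x v : Coord n) (i j k : Fin n) : ℝ :=
  christoffel (fun y => fundMatrix L e y v) x i j k

/-- `G^i(x, v) = ∑ γ^i_{jk} v^j v^k`. In particular `G^i(x, 0) = 0`. -/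
def spray (L : TangentBundle (𝓡 n) M → ℝ) (e : OpenPartialHomeomorph M (Coord n))
    (i : Fin n) (x v : Coord n) : ℝ :=
  ∑ j, ∑ k, formalChristoffel L e x v i j k * v j * v k

/-- `N^i_j(x, v) = ½ ∂G^i/∂v^j` for `v ≠ 0`, and `N^i_j(x, 0) = 0`. -/
def nonlinearConn (L : TangentBundle (𝓡 n) M → ℝ) (e : OpenPartialHomeomorph M (Coord n))
    (x v : Coord n) (i j : Fin n) : ℝ :=
  open Classical in if v = 0 then 0 else (1 / 2) * partialDeriv j (spray L e i x) v

/-- The coefficients `Γ^i_{jk}(x, v)` of the Chern connection of `L` (meaningful for `v ≠ 0`). -/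
def chernSymbol (L : TangentBundle (𝓡 n) M → ℝ) (e : OpenPartialHomeomorph M (Coord n))
    (x v : Coord n) (i j k : Fin n) : ℝ :=
  formalChristoffel L e x v i j k
    - (1 / 2) * ∑ l, ∑ m, (fundMatrix L e x v)⁻¹ i l *
      (partialDeriv m (fun u => fundMatrix L e x u l k) v * nonlinearConn L e x v m j
        + partialDeriv m (fun u => fundMatrix L e x u j l) v * nonlinearConn L e x v m k
        - partialDeriv m (fun u => fundMatrix L e x u j k) v * nonlinearConn L e x v m l)

/-- Berwald type: in local coordinates, `Γ^i_{jk}` is constant on each slit tangent space. -/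
def IsBerwald (L : TangentBundle (𝓡 n) M → ℝ) : Prop :=
  ∀ e : OpenPartialHomeomorph M (Coord n), IsChart e → ∀ x ∈ e.target,
    ∀ v w : Coord n, v ≠ 0 → w ≠ 0 → ∀ i j k : Fin n,
      chernSymbol L e x v i j k = chernSymbol L e x w i j k

/-! ### Lorentzian metrics -/

/-- The matrix `g_{ij}(x)` of a field of bilinear forms in the chart `e`. -/
def metricMatrix (g : (x : M) → TangentSpace (𝓡 n) x →L[ℝ] TangentSpace (𝓡 n) x →L[ℝ] ℝ)
    (e : OpenPartialHomeomorph M (Coord n)) (x : Coord n) : Matrix (Fin n) (Fin n) ℝ :=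
  Matrix.of fun i j => g (e.symm x) (ofCoord e x (coordVec i)) (ofCoord e x (coordVec j))

/-- `g` is a (smooth) Lorentzian metric on `M`. -/
structure IsLorentzMetric [IsManifold (𝓡 n) ∞ M]
    (g : (x : M) → TangentSpace (𝓡 n) x →L[ℝ] TangentSpace (𝓡 n) x →L[ℝ] ℝ) : Prop where
  smooth : ContMDiff (𝓡 n) ((𝓡 n).prod 𝓘(ℝ, Coord n →L[ℝ] Coord n →L[ℝ] ℝ)) ∞
    (fun x => (Bundle.TotalSpace.mk' (Coord n →L[ℝ] Coord n →L[ℝ] ℝ) x (g x) :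
      Bundle.TotalSpace (Coord n →L[ℝ] Coord n →L[ℝ] ℝ)
        (fun x : M => TangentSpace (𝓡 n) x →L[ℝ] TangentSpace (𝓡 n) x →L[ℝ] ℝ)))
  lorentzian : ∀ e : OpenPartialHomeomorph M (Coord n), IsChart e → ∀ x ∈ e.target,
    HasLorentzSignature (metricMatrix g e x)

/-- The Christoffel symbols of the Levi-Civita connection of `g` in the chart `e`. -/
def leviCivitaSymbol (g : (x : M) → TangentSpace (𝓡 n) x →L[ℝ] TangentSpace (𝓡 n) x →L[ℝ] ℝ)
    (e : OpenPartialHomeomorph M (Coord n)) (x : Coord n) (i j k : Fin n) : ℝ :=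
  christoffel (metricMatrix g e) x i j k

/-! ### Covariant derivatives along curves, parallel fields, geodesics

Curves are defined on an interval `J ⊆ ℝ`; derivatives at end points that belong to `J` are
one-sided. The definitions are stated for a family `Γ` of connection coefficients
`Γ e x w i j k = Γ^i_{jk}(x, w)`, depending on a chart `e`, coordinates `x` of a point and
components `w` of a reference vector, and are used for the Chern connection of `L`
(`chernSymbol L`) and for the Levi-Civita connection of `g` (no dependence on `w`). -/

/-- The velocity of the curve `η : J → M` at time `t`. -/
def velocity (J : Set ℝ) (η : ℝ → M) (t : ℝ) : TangentSpace (𝓡 n) (η t) :=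
  mfderivWithin 𝓘(ℝ, ℝ) (𝓡 n) η J t (1 : ℝ)

/-- The components in the chart `e` of `D_{η'}^{w} V` at time `t`, for a vector field `V` along
`η` and the reference vector `w`:
`dV^i/dt + ∑ Γ^i_{jk}(η(t), w) η'^j(t) V^k(t)`. -/
def covDerivAlong
    (Γ : OpenPartialHomeomorph M (Coord n) → Coord n → Coord n → Fin n → Fin n → Fin n → ℝ)
    (e : OpenPartialHomeomorph M (Coord n)) (J : Set ℝ) (η : ℝ → M)
    (V : (t : ℝ) → TangentSpace (𝓡 n) (η t)) (t : ℝ) (w : TangentSpace (𝓡 n) (η t))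
    (i : Fin n) : ℝ :=
  derivWithin (fun s => toCoord e (η s) (V s) i) J t
    + ∑ j, ∑ k, Γ e (e (η t)) (toCoord e (η t) w) i j k
        * toCoord e (η t) (velocity J η t) j * toCoord e (η t) (V t) k

/-- `V` is a (differentiable) vector field along the curve `η : J → M` that is parallel with
reference vector `η'`, that is, `D_{η'}^{η'} V = 0`. Since the covariant derivative is a tangent
vector, its vanishing at time `t` can be tested in any one chart around `η t`. -/
def IsParallelAlong
    (Γ : OpenPartialHomeomorph M (Coord n) → Coord n → Coord n → Fin n → Fin n → Fin n → ℝ)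
    (J : Set ℝ) (η : ℝ → M) (V : (t : ℝ) → TangentSpace (𝓡 n) (η t)) : Prop :=
  ∀ t ∈ J, ∃ e : OpenPartialHomeomorph M (Coord n), IsChart e ∧ η t ∈ e.source ∧
    DifferentiableWithinAt ℝ (fun s => toCoord e (η s) (V s)) J t ∧
    ∀ i, covDerivAlong Γ e J η V t (velocity J η t) i = 0

/-- Geodesics `η : J → M`: the `C²` curves with `D_{η'}^{η'} η' = 0`. (Where `η' = 0` the
equation reads `η'' = 0` in coordinates, whatever the value of `Γ` at the zero vector; so constant
curves are geodesics.) -/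
def IsGeodesic
    (Γ : OpenPartialHomeomorph M (Coord n) → Coord n → Coord n → Fin n → Fin n → Fin n → ℝ)
    (J : Set ℝ) (η : ℝ → M) : Prop :=
  ContMDiffOn 𝓘(ℝ, ℝ) (𝓡 n) 2 η J ∧ IsParallelAlong Γ J η (velocity J η)

/-- `η` is a geodesic of the Lorentz-Finsler structure `L` on the interval `J`. -/
def IsFinslerGeodesic (L : TangentBundle (𝓡 n) M → ℝ) (J : Set ℝ) (η : ℝ → M) : Prop :=
  IsGeodesic (chernSymbol L) J η

/-- `η` is a geodesic of the metric `g` on the interval `J`. -/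
def IsMetricGeodesic
    (g : (x : M) → TangentSpace (𝓡 n) x →L[ℝ] TangentSpace (𝓡 n) x →L[ℝ] ℝ)
    (J : Set ℝ) (η : ℝ → M) : Prop :=
  IsGeodesic (fun e x _ i j k => leviCivitaSymbol g e x i j k) J η

/-- The metric `g` is preserved by every `L`-parallel transport along `L`-geodesics: for any two
`L`-parallel fields `V`, `W` along a nonconstant `L`-geodesic `η : J → M` (these have
nowhere vanishing velocity), `g(V, W)` is constant. -/
def PreservedByParallelTransport (L : TangentBundle (𝓡 n) M → ℝ)
    (g : (x : M) → TangentSpace (𝓡 n) x →L[ℝ] TangentSpace (𝓡 n) x →L[ℝ] ℝ) : Prop :=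
  ∀ (J : Set ℝ) (η : ℝ → M), J.OrdConnected → J.Nontrivial →
    IsFinslerGeodesic L J η → (∀ t ∈ J, velocity (n := n) J η t ≠ 0) →
    ∀ V W : (t : ℝ) → TangentSpace (𝓡 n) (η t),
      IsParallelAlong (chernSymbol L) J η V → IsParallelAlong (chernSymbol L) J η W →
      ∀ s ∈ J, ∀ t ∈ J, g (η s) (V s) (W s) = g (η t) (V t) (W t)

end Manifold

end LorentzFinsler

end

/-! Fix a chart, a point x and v ≠ 0; repeated indices are summed. Let V and W be parallel along the
L-geodesic with initial velocity v, with initial values the coordinate vectors e_j and e_k. Since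
Γ^a_{jk} v^k = N^a_j, their components satisfy V' = -N_j and W' = -N_k at time 0. Differentiating
the constant g(V, W) there gives, for every v ≠ 0, (*) v^l ∂_l g_{jk} = g_{ak} N^a_j(v) + g_{ja}
N^a_k(v) (`sum_mul_partialDeriv_metricMatrix`).

This is metric compatibility of a connection that may depend nonlinearly on v. What pins it down is
that N comes from a spray: N^a_j = ½ ∂G^a/∂v^j and N^a_j v^j = G^a. Contract (*) with v^j v^k,
differentiate in v^c, and eliminate N by means of (*) contracted once. The outcome is g_{ca} G^a =
v^k v^l ∂_l g_{ck} - ½ v^j v^k ∂_c g_{jk}, so G is the geodesic spray of g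
(`sum_mul_spray_of_preserved`) and in particular is quadratic in v.

It remains to recover Γ from G. For any L the horizontal derivative δ_j L vanishes
(`IsLocalSpray.dX_eq_sum_sprayConn`). Once N^m_j = C^m_{jk} v^k is linear, two vertical derivatives
of δ_j L = 0 say that the symmetric coefficients C are compatible with the Hessian ∂²L/∂v^a∂v^b
under δ. Koszul's computation then gives Γ = C (`IsLocalSpray.loweredChern_of_linear`,
`chernSymbol_of_quadratic`). The Berwald property is immediate, and geodesics agree because the
connection term vanishes wherever η' = 0 (`IsGeodesic.congr`). -/

noncomputable section

namespace LorentzFinsler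

/-! ### Directional derivatives of smooth functions -/

section DirDeriv

variable {Z : Type*} [NormedAddCommGroup Z] [NormedSpace ℝ Z]

/-- The derivative of `f` in the direction `w`. -/
def dirDeriv (w : Z) (f : Z → ℝ) (z : Z) : ℝ := fderiv ℝ f z w

variable {Ω : Set Z} {f g : Z → ℝ} {z : Z}

lemma contDiffOn_dirDeriv (hΩ : IsOpen Ω) (hf : ContDiffOn ℝ ∞ f Ω) (w : Z) :
    ContDiffOn ℝ ∞ (dirDeriv w f) Ω :=
  (hf.fderiv_of_isOpen hΩ (m := ∞) (by simp)).clm_apply contDiffOn_const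

lemma differentiableAt_of_contDiffOn (hΩ : IsOpen Ω) (hf : ContDiffOn ℝ ∞ f Ω) (hz : z ∈ Ω) :
    DifferentiableAt ℝ f z :=
  (hf.contDiffAt (hΩ.mem_nhds hz)).differentiableAt (by simp)

lemma dirDeriv_comm (hΩ : IsOpen Ω) (hf : ContDiffOn ℝ ∞ f Ω) (hz : z ∈ Ω) (w u : Z) :
    dirDeriv w (dirDeriv u f) z = dirDeriv u (dirDeriv w f) z := by
  have hz' := hf.contDiffAt (hΩ.mem_nhds hz)
  have hd : DifferentiableAt ℝ (fderiv ℝ f) z :=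
    (hz'.fderiv_right (m := 1) (by norm_cast)).differentiableAt (by simp)
  have hs : IsSymmSndFDerivAt ℝ f z :=
    hz'.isSymmSndFDerivAt (by
      rw [minSmoothness_of_isRCLikeNormedField]; norm_cast)
  have key : ∀ a b : Z, dirDeriv a (dirDeriv b f) z = fderiv ℝ (fderiv ℝ f) z a b := by
    intro a b
    unfold dirDeriv
    rw [fderiv_clm_apply hd (differentiableAt_const b)]
    simp
  rw [key, key]
  exact hs.eq w u

lemma dirDeriv_congr (hΩ : IsOpen Ω) (h : Set.EqOn f g Ω) (hz : z ∈ Ω) (w : Z) :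
    dirDeriv w f z = dirDeriv w g z := by
  unfold dirDeriv
  rw [(h.eventuallyEq_of_mem (hΩ.mem_nhds hz)).fderiv_eq]

lemma dirDeriv_add (hf : DifferentiableAt ℝ f z) (hg : DifferentiableAt ℝ g z) (w : Z) :
    dirDeriv w (fun y => f y + g y) z = dirDeriv w f z + dirDeriv w g z := by
  simp [dirDeriv, fderiv_fun_add hf hg]

lemma dirDeriv_sub (hf : DifferentiableAt ℝ f z) (hg : DifferentiableAt ℝ g z) (w : Z) :
    dirDeriv w (fun y => f y - g y) z = dirDeriv w f z - dirDeriv w g z := by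
  simp [dirDeriv, fderiv_fun_sub hf hg]

lemma dirDeriv_const_mul (hf : DifferentiableAt ℝ f z) (c : ℝ) (w : Z) :
    dirDeriv w (fun y => c * f y) z = c * dirDeriv w f z := by
  simp [dirDeriv, fderiv_const_mul hf c]

lemma dirDeriv_mul (hf : DifferentiableAt ℝ f z) (hg : DifferentiableAt ℝ g z) (w : Z) :
    dirDeriv w (fun y => f y * g y) z = dirDeriv w f z * g z + f z * dirDeriv w g z := by
  simp [dirDeriv, fderiv_fun_mul hf hg]; ring

lemma dirDeriv_sum {ι : Type*} {s : Finset ι} {a : ι → Z → ℝ}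
    (ha : ∀ i ∈ s, DifferentiableAt ℝ (a i) z) (w : Z) :
    dirDeriv w (fun y => ∑ i ∈ s, a i y) z = ∑ i ∈ s, dirDeriv w (a i) z := by
  simp [dirDeriv, fderiv_fun_sum ha]

lemma differentiableAt_sum_mul {ι : Type*} {s : Finset ι} {a b : ι → Z → ℝ}
    (ha : ∀ i, DifferentiableAt ℝ (a i) z) (hb : ∀ i, DifferentiableAt ℝ (b i) z) :
    DifferentiableAt ℝ (fun y => ∑ i ∈ s, a i y * b i y) z :=
  DifferentiableAt.fun_sum fun i _ => (ha i).mul (hb i)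

lemma dirDeriv_sum_mul {ι : Type*} {s : Finset ι} {a b : ι → Z → ℝ}
    (ha : ∀ i, DifferentiableAt ℝ (a i) z) (hb : ∀ i, DifferentiableAt ℝ (b i) z) (w : Z) :
    dirDeriv w (fun y => ∑ i ∈ s, a i y * b i y) z =
      ∑ i ∈ s, (dirDeriv w (a i) z * b i z + a i z * dirDeriv w (b i) z) := by
  rw [dirDeriv_sum (a := fun i y => a i y * b i y) (fun i _ => (ha i).mul (hb i))]
  exact Finset.sum_congr rfl fun i _ => dirDeriv_mul (ha i) (hb i) w

end DirDeriv

/-! ### Calculus in the coordinates (x, v) and Euler's homogeneity identity -/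

section Slit

variable {n : ℕ}

/-- The partial derivative `∂/∂x^j` of a function of `(x, v)`. -/
def dX (j : Fin n) (f : Coord n × Coord n → ℝ) : Coord n × Coord n → ℝ :=
  dirDeriv (coordVec j, 0) f

/-- The partial derivative `∂/∂v^j` of a function of `(x, v)`. -/
def dV (j : Fin n) (f : Coord n × Coord n → ℝ) : Coord n × Coord n → ℝ :=
  dirDeriv (0, coordVec j) f

/-- This and its companion for v replace iterated partial derivatives in separate variables by
directional derivatives on the product, where all of them commute. -/
lemma partialDeriv_left {f : Coord n × Coord n → ℝ} {x v : Coord n}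
    (hf : DifferentiableAt ℝ f (x, v)) (j : Fin n) :
    partialDeriv j (fun y => f (y, v)) x = dX j f (x, v) := by
  have h1 : HasFDerivAt (fun y : Coord n => (y, v)) (ContinuousLinearMap.inl ℝ _ _) x :=
    hasFDerivAt_prodMk_left x v
  have h2 := HasFDerivAt.comp (f := fun y : Coord n => (y, v)) (g := f) x hf.hasFDerivAt h1
  have h3 : fderiv ℝ (fun y => f (y, v)) x = _ := h2.fderiv
  simp [partialDeriv, dX, dirDeriv, h3]

lemma partialDeriv_right {f : Coord n × Coord n → ℝ} {x v : Coord n}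
    (hf : DifferentiableAt ℝ f (x, v)) (j : Fin n) :
    partialDeriv j (fun u => f (x, u)) v = dV j f (x, v) := by
  have h1 : HasFDerivAt (fun u : Coord n => (x, u)) (ContinuousLinearMap.inr ℝ _ _) v :=
    hasFDerivAt_prodMk_right x v
  have h2 := HasFDerivAt.comp (f := fun y : Coord n => (x, y)) (g := f) v hf.hasFDerivAt h1
  have h3 : fderiv ℝ (fun y => f (x, y)) v = _ := h2.fderiv
  simp [partialDeriv, dV, dirDeriv, h3]

lemma contDiff_snd_apply (k : Fin n) :
    ContDiff ℝ ∞ (fun p : Coord n × Coord n => p.2 k) := by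
  fun_prop

lemma dirDeriv_snd_apply (k : Fin n) (w p : Coord n × Coord n) :
    dirDeriv w (fun p : Coord n × Coord n => p.2 k) p = w.2 k := by
  have : HasFDerivAt (fun p : Coord n × Coord n => p.2 k)
      ((EuclideanSpace.proj k : Coord n →L[ℝ] ℝ).comp (ContinuousLinearMap.snd ℝ _ _)) p :=
    ContinuousLinearMap.hasFDerivAt (x := p) ((EuclideanSpace.proj k : Coord n →L[ℝ] ℝ).comp
      (ContinuousLinearMap.snd ℝ (Coord n) (Coord n)))
  simp [dirDeriv, this.fderiv]

/-- The Euler vector field `∑ v^k ∂/∂v^k`. -/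
def euler (f : Coord n × Coord n → ℝ) (p : Coord n × Coord n) : ℝ := ∑ k, p.2 k * dV k f p

variable {Ω : Set (Coord n × Coord n)} {f g : Coord n × Coord n → ℝ} {p : Coord n × Coord n}

/-- The commutator of a constant vector field w with the Euler field is the vertical part of w.
Hence a v-derivative lowers the degree of homogeneity by one and an x-derivative preserves it, as
the next two lemmas record. -/
lemma dirDeriv_euler (hΩ : IsOpen Ω) (hf : ContDiffOn ℝ ∞ f Ω) (hp : p ∈ Ω)
    (w : Coord n × Coord n) :
    dirDeriv w (euler f) p = ∑ k, w.2 k * dV k f p + euler (dirDeriv w f) p := by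
  have h1 : ∀ k : Fin n, DifferentiableAt ℝ (fun p : Coord n × Coord n => p.2 k) p :=
    fun k => (contDiff_snd_apply k).differentiable (by simp) p
  have h2 : ∀ k : Fin n, DifferentiableAt ℝ (dV k f) p := fun k =>
    differentiableAt_of_contDiffOn hΩ (contDiffOn_dirDeriv hΩ hf _) hp
  unfold euler
  rw [dirDeriv_sum_mul h1 h2, Finset.sum_add_distrib]
  congr 1
  · simp only [dirDeriv_snd_apply]
  · refine Finset.sum_congr rfl fun k _ => ?_
    rw [dV, dirDeriv_comm hΩ hf hp]; rfl

lemma euler_dV (hΩ : IsOpen Ω) (hf : ContDiffOn ℝ ∞ f Ω) {c : ℝ}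
    (h : ∀ p ∈ Ω, euler f p = c * f p) (l : Fin n) :
    ∀ p ∈ Ω, euler (dV l f) p = (c - 1) * dV l f p := by
  intro p hp
  have h1 := dirDeriv_euler hΩ hf hp (0, coordVec l)
  rw [dirDeriv_congr hΩ (g := fun p => c * f p) (fun p hp => h p hp) hp,
    dirDeriv_const_mul (differentiableAt_of_contDiffOn hΩ hf hp)] at h1
  have h2 : ∑ k, (coordVec l : Coord n) k * dV k f p = dV l f p := by
    simp [coordVec]
  simp only [h2] at h1
  change c * dV l f p = dV l f p + euler (dV l f) p at h1
  linarith

lemma euler_dX (hΩ : IsOpen Ω) (hf : ContDiffOn ℝ ∞ f Ω) {c : ℝ}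
    (h : ∀ p ∈ Ω, euler f p = c * f p) (l : Fin n) :
    ∀ p ∈ Ω, euler (dX l f) p = c * dX l f p := by
  intro p hp
  have h1 := dirDeriv_euler hΩ hf hp (coordVec l, 0)
  rw [dirDeriv_congr hΩ (g := fun p => c * f p) (fun p hp => h p hp) hp,
    dirDeriv_const_mul (differentiableAt_of_contDiffOn hΩ hf hp)] at h1
  simp only [PiLp.zero_apply, zero_mul, Finset.sum_const_zero, zero_add] at h1
  exact h1.symm

lemma euler_eq_dirDeriv (f : Coord n × Coord n → ℝ) (p : Coord n × Coord n) :
    euler f p = dirDeriv (0, p.2) f p := by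
  have h : ((0, p.2) : Coord n × Coord n) =
      ∑ k, p.2 k • ((0 : Coord n), (coordVec k : Coord n)) := by
    refine Prod.ext (by simp [Prod.fst_sum]) ?_
    ext i
    simp [Prod.snd_sum, coordVec, Pi.single_apply]
  rw [dirDeriv, h, map_sum]
  simp only [map_smul, smul_eq_mul]
  rfl

end Slit

/-! ### Spray, nonlinear connection and Chern symbols of a homogeneous Lagrangian -/

section LocalSpray

variable {n : ℕ}

/-- The function `F` of `(x, v)` is smooth on the open set `Ω`, and `2`-homogeneous and
non-degenerate in `v`. -/
structure IsLocalLagrangian (Ω : Set (Coord n × Coord n)) (F : Coord n × Coord n → ℝ) : Prop where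
  isOpen : IsOpen Ω
  smooth : ContDiffOn ℝ ∞ F Ω
  euler_eq : ∀ p ∈ Ω, euler F p = 2 * F p
  nondegenerate : ∀ p ∈ Ω, IsUnit (Matrix.of fun i j => dV i (dV j F) p).det

/-- The functions `G^i` are the coefficients of the geodesic spray of the Lagrangian `F`. -/
structure IsLocalSpray (Ω : Set (Coord n × Coord n)) (F : Coord n × Coord n → ℝ)
    (G : Fin n → Coord n × Coord n → ℝ) : Prop extends IsLocalLagrangian Ω F where
  smooth_spray : ∀ i, ContDiffOn ℝ ∞ (G i) Ω
  lagrange : ∀ p ∈ Ω, ∀ l, ∑ i, dV l (dV i F) p * G i p =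
    ∑ k, p.2 k * dX k (dV l F) p - dX l F p

/-- Identities between objects with an upper index are proved after lowering that index with a
non-degenerate matrix, which avoids handling the inverse. -/
lemma sum_mul_injective {A : Matrix (Fin n) (Fin n) ℝ} (hA : IsUnit A.det) {c d : Fin n → ℝ}
    (h : ∀ l, ∑ i, A l i * c i = ∑ i, A l i * d i) : c = d :=
  (Matrix.mulVec_injective_iff_isUnit.2 ((Matrix.isUnit_iff_isUnit_det _).2 hA)) (funext h)

/-- The nonlinear connection `N^i_j = ½ ∂G^i/∂v^j`. -/
def sprayConn (G : Fin n → Coord n × Coord n → ℝ) (i j : Fin n) (p : Coord n × Coord n) : ℝ :=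
  (1 / 2) * dV j (G i) p

/-- The horizontal derivative `δ_j f = ∂f/∂x^j - N^m_j ∂f/∂v^m`. -/
def horizDeriv (G : Fin n → Coord n × Coord n → ℝ) (j : Fin n) (f : Coord n × Coord n → ℝ)
    (p : Coord n × Coord n) : ℝ :=
  dX j f p - ∑ m, sprayConn G m j p * dV m f p

/-- The Chern symbols with lowered index, `Γ_{ljk} = ½ (δ_j g_{lk} + δ_k g_{jl} - δ_l g_{jk})`. -/
def loweredChern (F : Coord n × Coord n → ℝ) (G : Fin n → Coord n × Coord n → ℝ)
    (l j k : Fin n) (p : Coord n × Coord n) : ℝ :=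
  (1 / 2) * (horizDeriv G j (dV l (dV k F)) p + horizDeriv G k (dV j (dV l F)) p
    - horizDeriv G l (dV j (dV k F)) p)

namespace IsLocalLagrangian

variable {Ω : Set (Coord n × Coord n)} {F : Coord n × Coord n → ℝ} (S : IsLocalLagrangian Ω F)
  {p : Coord n × Coord n}

include S

lemma smooth_dV (i : Fin n) : ContDiffOn ℝ ∞ (dV i F) Ω :=
  contDiffOn_dirDeriv S.isOpen S.smooth _

lemma smooth_dX (i : Fin n) : ContDiffOn ℝ ∞ (dX i F) Ω :=
  contDiffOn_dirDeriv S.isOpen S.smooth _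

lemma smooth_dVdV (i j : Fin n) : ContDiffOn ℝ ∞ (dV i (dV j F)) Ω :=
  contDiffOn_dirDeriv S.isOpen (S.smooth_dV _) _

lemma smooth_dXdV (i j : Fin n) : ContDiffOn ℝ ∞ (dX i (dV j F)) Ω :=
  contDiffOn_dirDeriv S.isOpen (S.smooth_dV _) _

lemma dVdV_comm (hp : p ∈ Ω) (i j : Fin n) : dV i (dV j F) p = dV j (dV i F) p :=
  dirDeriv_comm S.isOpen S.smooth hp _ _

lemma dVdX_comm (hp : p ∈ Ω) (i j : Fin n) : dV i (dX j F) p = dX j (dV i F) p :=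
  dirDeriv_comm S.isOpen S.smooth hp _ _

lemma dirDeriv_dVdV_comm (hp : p ∈ Ω) (w : Coord n × Coord n) (i j : Fin n) :
    dirDeriv w (dV i (dV j F)) p = dirDeriv w (dV j (dV i F)) p :=
  dirDeriv_congr S.isOpen (fun _ hq => S.dVdV_comm hq i j) hp w

lemma dVdVdV_comm (hp : p ∈ Ω) (i j k : Fin n) :
    dV i (dV j (dV k F)) p = dV j (dV i (dV k F)) p :=
  dirDeriv_comm S.isOpen (S.smooth_dV k) hp _ _

lemma dVdXdV_comm (hp : p ∈ Ω) (i j k : Fin n) :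
    dV i (dX j (dV k F)) p = dX j (dV i (dV k F)) p :=
  dirDeriv_comm S.isOpen (S.smooth_dV k) hp _ _

lemma euler_dV_eq (hp : p ∈ Ω) (l : Fin n) : ∑ k, p.2 k * dV k (dV l F) p = dV l F p := by
  have := euler_dV S.isOpen S.smooth S.euler_eq l p hp
  unfold euler at this
  linarith

lemma euler_dVdV_eq (hp : p ∈ Ω) (j l : Fin n) :
    ∑ k, p.2 k * dV k (dV j (dV l F)) p = 0 := by
  have := euler_dV S.isOpen (S.smooth_dV l) (euler_dV S.isOpen S.smooth S.euler_eq l) j p hp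
  unfold euler at this
  linarith

lemma euler_dX_eq (hp : p ∈ Ω) (l : Fin n) :
    ∑ k, p.2 k * dX l (dV k F) p = 2 * dX l F p := by
  have := euler_dX S.isOpen S.smooth S.euler_eq l p hp
  unfold euler at this
  rw [← this]
  exact Finset.sum_congr rfl fun k _ => by rw [S.dVdX_comm hp]

lemma euler_dXdV_eq (hp : p ∈ Ω) (j l : Fin n) :
    ∑ k, p.2 k * dX j (dV k (dV l F)) p = dX j (dV l F) p := by
  have := euler_dX S.isOpen (S.smooth_dV l) (euler_dV S.isOpen S.smooth S.euler_eq l) j p hp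
  unfold euler at this
  rw [show dX j (dV l F) p = (2 - 1) * dX j (dV l F) p by ring, ← this]
  exact Finset.sum_congr rfl fun k _ => by rw [S.dVdXdV_comm hp]

end IsLocalLagrangian

namespace IsLocalSpray

variable {Ω : Set (Coord n × Coord n)} {F : Coord n × Coord n → ℝ}
  {G : Fin n → Coord n × Coord n → ℝ} (S : IsLocalSpray Ω F G)
  {p : Coord n × Coord n}

include S

lemma smooth_sprayConn (i j : Fin n) : ContDiffOn ℝ ∞ (sprayConn G i j) Ω :=
  contDiffOn_const.mul (contDiffOn_dirDeriv S.isOpen (S.smooth_spray i) _)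

/-- The derivative of the Euler-Lagrange equation. -/
lemma dirDeriv_lagrange (hp : p ∈ Ω) (w : Coord n × Coord n) (l : Fin n) :
    ∑ i, (dirDeriv w (dV l (dV i F)) p * G i p + dV l (dV i F) p * dirDeriv w (G i) p) =
      ∑ k, (w.2 k * dX k (dV l F) p + p.2 k * dirDeriv w (dX k (dV l F)) p)
        - dirDeriv w (dX l F) p := by
  have hv : ∀ k : Fin n, DifferentiableAt ℝ (fun p : Coord n × Coord n => p.2 k) p :=
    fun k => (contDiff_snd_apply k).differentiable (by simp) p
  have hd : ∀ {f : Coord n × Coord n → ℝ}, ContDiffOn ℝ ∞ f Ω → DifferentiableAt ℝ f p :=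
    fun hf => differentiableAt_of_contDiffOn S.isOpen hf hp
  have h := dirDeriv_congr S.isOpen (fun q hq => S.lagrange q hq l) hp w
  rw [dirDeriv_sum_mul (fun i => hd (S.smooth_dVdV l i)) (fun i => hd (S.smooth_spray i)),
    dirDeriv_sub (differentiableAt_sum_mul hv fun k => hd (S.smooth_dXdV k l))
      (hd (S.smooth_dX l)), dirDeriv_sum_mul hv (fun k => hd (S.smooth_dXdV k l))] at h
  simpa only [dirDeriv_snd_apply] using h

/-- Differentiate the Euler-Lagrange equation in the direction (0, v). The Hessian has degree 0 and
the right-hand side has degree 2, so non-degeneracy forces degree 2 on G. -/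
lemma euler_spray (hp : p ∈ Ω) (i : Fin n) : euler (G i) p = 2 * G i p := by
  have key : (fun i => euler (G i) p) = fun i => 2 * G i p := by
    refine sum_mul_injective (S.nondegenerate p hp) fun l => ?_
    simp only [Matrix.of_apply]
    have h := S.dirDeriv_lagrange hp (0, p.2) l
    simp only [← euler_eq_dirDeriv] at h
    have h1 : ∀ i, euler (dV l (dV i F)) p = 0 := fun i => S.euler_dVdV_eq hp l i
    have h2 : ∀ k, euler (dX k (dV l F)) p = dX k (dV l F) p := fun k => by
      rw [euler_dX S.isOpen (S.smooth_dV l) (euler_dV S.isOpen S.smooth S.euler_eq l) k p hp]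
      ring
    simp only [h1, h2, zero_mul, zero_add, Finset.sum_add_distrib,
      euler_dX S.isOpen S.smooth S.euler_eq l p hp] at h
    have h3 := S.lagrange p hp l
    rw [h]
    have h4 : ∑ i, dV l (dV i F) p * (2 * G i p) = 2 * ∑ i, dV l (dV i F) p * G i p := by
      rw [Finset.mul_sum]; exact Finset.sum_congr rfl fun i _ => by ring
    rw [h4, h3]; ring
  exact congrFun key i

lemma sum_sprayConn_mul (hp : p ∈ Ω) (i : Fin n) : ∑ j, sprayConn G i j p * p.2 j = G i p := by
  have h := S.euler_spray hp i
  unfold euler at h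
  have : ∑ j, sprayConn G i j p * p.2 j = (1 / 2) * ∑ k, p.2 k * dV k (G i) p := by
    rw [Finset.mul_sum]; exact Finset.sum_congr rfl fun i _ => by unfold sprayConn; ring
  rw [this, h]; ring

/-- The equation of the nonlinear connection. -/
lemma sum_dVdV_mul_sprayConn (hp : p ∈ Ω) (j l : Fin n) :
    ∑ i, dV j (dV l (dV i F)) p * G i p + 2 * ∑ i, dV l (dV i F) p * sprayConn G i j p =
      dX j (dV l F) p + ∑ k, p.2 k * dX k (dV j (dV l F)) p - dX l (dV j F) p := by
  have h := S.dirDeriv_lagrange hp (0, coordVec j) l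
  simp only [Finset.sum_add_distrib] at h
  have h1 : ∑ k, (coordVec j : Coord n) k * dX k (dV l F) p = dX j (dV l F) p := by
    simp [coordVec]
  rw [h1] at h
  change _ + ∑ i, _ * dV j (G i) p = _ + ∑ k, _ * dV j (dX k (dV l F)) p - dV j (dX l F) p at h
  rw [S.dVdX_comm hp] at h
  simp only [S.dVdXdV_comm hp] at h
  rw [← h]
  congr 1
  rw [Finset.mul_sum]
  exact Finset.sum_congr rfl fun i _ => by unfold sprayConn; ring

/-- The Lagrangian is constant in horizontal directions. -/
lemma dX_eq_sum_sprayConn (hp : p ∈ Ω) (j : Fin n) :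
    dX j F p = ∑ m, sprayConn G m j p * dV m F p := by
  -- Contract the equation of the nonlinear connection with v^l. By homogeneity the third-derivative
  -- term vanishes and the last two terms on the right cancel.
  have h : ∑ l, p.2 l * (∑ i, dV j (dV l (dV i F)) p * G i p
      + 2 * ∑ i, dV l (dV i F) p * sprayConn G i j p) =
      ∑ l, p.2 l * (dX j (dV l F) p + ∑ k, p.2 k * dX k (dV j (dV l F)) p - dX l (dV j F) p) :=
    Finset.sum_congr rfl fun l _ => by rw [S.sum_dVdV_mul_sprayConn hp j l]
  have h1 : ∑ l, p.2 l * ∑ i, dV j (dV l (dV i F)) p * G i p = 0 := by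
    simp_rw [Finset.mul_sum]
    rw [Finset.sum_comm]
    refine Finset.sum_eq_zero fun i _ => ?_
    have := S.euler_dVdV_eq hp j i
    simp_rw [S.dVdVdV_comm hp j, ← mul_assoc]
    rw [← Finset.sum_mul, this, zero_mul]
  have h2 : ∑ l, p.2 l * (2 * ∑ i, dV l (dV i F) p * sprayConn G i j p) =
      2 * ∑ m, sprayConn G m j p * dV m F p := by
    simp_rw [Finset.mul_sum]
    rw [Finset.sum_comm]
    refine Finset.sum_congr rfl fun i _ => ?_
    rw [← S.euler_dV_eq hp i, Finset.mul_sum, Finset.mul_sum]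
    exact Finset.sum_congr rfl fun l _ => by ring
  have h3 : ∑ l, p.2 l * ∑ k, p.2 k * dX k (dV j (dV l F)) p =
      ∑ l, p.2 l * dX l (dV j F) p := by
    simp_rw [Finset.mul_sum]
    rw [Finset.sum_comm]
    refine Finset.sum_congr rfl fun k _ => ?_
    rw [← S.euler_dXdV_eq hp k j, Finset.mul_sum]
    refine Finset.sum_congr rfl fun l _ => ?_
    have : dX k (dV j (dV l F)) p = dX k (dV l (dV j F)) p := S.dirDeriv_dVdV_comm hp _ j l
    rw [this]; ring
  simp only [mul_add, mul_sub, Finset.sum_add_distrib, Finset.sum_sub_distrib] at h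
  rw [h1, h2, h3, S.euler_dX_eq hp j] at h
  linarith

/-- Contracting with v^k kills the third vertical derivatives in the two terms where k indexes the
Hessian. In the term with δ_k they survive multiplied by N^m_k v^k = G^m. The result is half the
right-hand side of the equation for N, with its G-term moved over. -/
lemma sum_loweredChern_mul (hp : p ∈ Ω) (l j : Fin n) :
    ∑ k, loweredChern F G l j k p * p.2 k = ∑ i, dV l (dV i F) p * sprayConn G i j p := by
  have hz : ∀ a b : Fin n, ∑ k, p.2 k * horizDeriv G a (dV b (dV k F)) p = dX a (dV b F) p := by
    intro a b
    simp only [horizDeriv, mul_sub, Finset.sum_sub_distrib]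
    have h1 : ∑ k, p.2 k * dX a (dV b (dV k F)) p = dX a (dV b F) p := by
      rw [← S.euler_dXdV_eq hp a b]
      exact Finset.sum_congr rfl fun k _ => congrArg _ (S.dirDeriv_dVdV_comm hp _ b k)
    have h2 : ∑ k, p.2 k * ∑ m, sprayConn G m a p * dV m (dV b (dV k F)) p = 0 := by
      simp_rw [Finset.mul_sum]
      rw [Finset.sum_comm]
      refine Finset.sum_eq_zero fun m _ => ?_
      rw [← mul_zero (sprayConn G m a p), ← S.euler_dVdV_eq hp m b, Finset.mul_sum]
      refine Finset.sum_congr rfl fun k _ => ?_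
      have : dV m (dV b (dV k F)) p = dV k (dV m (dV b F)) p := by
        rw [← S.dVdVdV_comm hp m k b]
        exact S.dirDeriv_dVdV_comm hp _ b k
      rw [this]; ring
    rw [h1, h2, sub_zero]
  have hG : ∑ k, p.2 k * horizDeriv G k (dV j (dV l F)) p =
      ∑ k, p.2 k * dX k (dV j (dV l F)) p - ∑ i, dV j (dV l (dV i F)) p * G i p := by
    simp only [horizDeriv, mul_sub, Finset.sum_sub_distrib]
    congr 1
    simp_rw [Finset.mul_sum]
    rw [Finset.sum_comm]
    refine Finset.sum_congr rfl fun m _ => ?_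
    have : dV m (dV j (dV l F)) p = dV j (dV l (dV m F)) p := by
      rw [S.dVdVdV_comm hp m j l]
      exact S.dirDeriv_dVdV_comm hp _ m l
    rw [← S.sum_sprayConn_mul hp m, this, Finset.mul_sum]
    exact Finset.sum_congr rfl fun k _ => by ring
  have h : ∑ k, loweredChern F G l j k p * p.2 k =
      (1 / 2) * (∑ k, p.2 k * horizDeriv G j (dV l (dV k F)) p
        + ∑ k, p.2 k * horizDeriv G k (dV j (dV l F)) p
        - ∑ k, p.2 k * horizDeriv G l (dV j (dV k F)) p) := by
    rw [← Finset.sum_add_distrib, ← Finset.sum_sub_distrib, Finset.mul_sum]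
    exact Finset.sum_congr rfl fun k _ => by unfold loweredChern; ring
  rw [h, hz, hz, hG]
  have := S.sum_dVdV_mul_sprayConn hp j l
  linarith

/-- Where the nonlinear connection is linear in `v`, the vertical derivatives of its coefficients
make `∂²F/∂v^a∂v^b` horizontally parallel. -/
lemma horizDeriv_dVdV (hp : p ∈ Ω) (j a b : Fin n)
    (h0 : ∀ m, dV b (dV a (sprayConn G m j)) p = 0) :
    horizDeriv G j (dV b (dV a F)) p =
      ∑ m, (dV a (sprayConn G m j) p * dV m (dV b F) p
        + dV b (sprayConn G m j) p * dV m (dV a F) p) := by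
  have hd : ∀ {f : Coord n × Coord n → ℝ}, ContDiffOn ℝ ∞ f Ω → ∀ q ∈ Ω,
      DifferentiableAt ℝ f q :=
    fun hf q hq => differentiableAt_of_contDiffOn S.isOpen hf hq
  have sN : ∀ m, ContDiffOn ℝ ∞ (dV a (sprayConn G m j)) Ω :=
    fun m => contDiffOn_dirDeriv S.isOpen (S.smooth_sprayConn m j) _
  have h1 : ∀ q ∈ Ω, dX j (dV a F) q = ∑ m, dV a (sprayConn G m j) q * dV m F q
      + ∑ m, sprayConn G m j q * dV a (dV m F) q := by
    -- First vertical derivative of δ_j F = 0, needed on all of Ω because it is differentiated once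
    -- more below.
    intro q hq
    have := dirDeriv_congr S.isOpen (fun r hr => S.dX_eq_sum_sprayConn hr j) hq (0, coordVec a)
    rw [dirDeriv_sum_mul (fun m => hd (S.smooth_sprayConn m j) q hq)
      (fun m => hd (S.smooth_dV m) q hq), Finset.sum_add_distrib] at this
    rw [← S.dVdX_comm hq a j]
    exact this
  have h2 := dirDeriv_congr S.isOpen h1 hp (0, coordVec b)
  rw [dirDeriv_add
      (differentiableAt_sum_mul (fun m => hd (sN m) p hp) fun m => hd (S.smooth_dV m) p hp)
      (differentiableAt_sum_mul (fun m => hd (S.smooth_sprayConn m j) p hp)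
        fun m => hd (S.smooth_dVdV a m) p hp),
    dirDeriv_sum_mul (fun m => hd (sN m) p hp) (fun m => hd (S.smooth_dV m) p hp),
    dirDeriv_sum_mul (fun m => hd (S.smooth_sprayConn m j) p hp)
      (fun m => hd (S.smooth_dVdV a m) p hp)] at h2
  change dV b (dX j (dV a F)) p =
    ∑ m, (dV b (dV a (sprayConn G m j)) p * dV m F p
      + dV a (sprayConn G m j) p * dV b (dV m F) p)
    + ∑ m, (dV b (sprayConn G m j) p * dV a (dV m F) p
      + sprayConn G m j p * dV b (dV a (dV m F)) p) at h2
  rw [S.dVdXdV_comm hp] at h2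
  rw [horizDeriv, h2, ← Finset.sum_add_distrib, ← Finset.sum_sub_distrib]
  refine Finset.sum_congr rfl fun m _ => ?_
  have : dV b (dV a (dV m F)) p = dV m (dV b (dV a F)) p := by
    rw [S.dVdVdV_comm hp m b a]
    exact S.dirDeriv_dVdV_comm hp _ a m
  rw [h0, this, S.dVdV_comm hp b m, S.dVdV_comm hp a m]
  ring

/-- The Koszul argument: compatibility of C with the Hessian, inserted into the alternating sum of
the three horizontal derivatives, leaves a single term because C is symmetric in its lower indices.
-/
lemma loweredChern_of_linear (hp : p ∈ Ω) (C : Fin n → Fin n → Fin n → ℝ)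
    (hC : ∀ m j a, C m j a = C m a j)
    (h1 : ∀ m j a, dV a (sprayConn G m j) p = C m j a)
    (h2 : ∀ m j a b, dV b (dV a (sprayConn G m j)) p = 0) (l j k : Fin n) :
    loweredChern F G l j k p = ∑ m, dV l (dV m F) p * C m j k := by
  have h : ∀ j a b, horizDeriv G j (dV b (dV a F)) p =
      ∑ m, C m j a * dV m (dV b F) p + ∑ m, C m j b * dV m (dV a F) p := by
    intro j a b
    rw [S.horizDeriv_dVdV hp j a b (fun m => h2 m j a b), Finset.sum_add_distrib]
    simp only [h1]
  have e1 : ∑ m, C m k j * dV m (dV l F) p = ∑ m, dV l (dV m F) p * C m j k :=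
    Finset.sum_congr rfl fun m _ => by rw [hC, S.dVdV_comm hp m l]; ring
  have e2 : ∑ m, C m j k * dV m (dV l F) p = ∑ m, dV l (dV m F) p * C m j k :=
    Finset.sum_congr rfl fun m _ => by rw [S.dVdV_comm hp m l]; ring
  have e3 : ∀ q, ∑ m, C m j l * dV m (dV q F) p = ∑ m, C m l j * dV m (dV q F) p :=
    fun q => Finset.sum_congr rfl fun m _ => by rw [hC]
  have e4 : ∀ q, ∑ m, C m k l * dV m (dV q F) p = ∑ m, C m l k * dV m (dV q F) p :=
    fun q => Finset.sum_congr rfl fun m _ => by rw [hC]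
  rw [loweredChern, h, h, h, e1, e2, e3, e4]
  ring

end IsLocalSpray

end LocalSpray

/-! ### Lorentzian matrices and Christoffel symbols -/

section Matrices

variable {n : ℕ} {A : Matrix (Fin n) (Fin n) ℝ}

lemma HasLorentzSignature.isUnit_det (h : HasLorentzSignature A) : IsUnit A.det := by
  obtain ⟨P, i₀, hP, hA⟩ := h
  have h1 := congrArg Matrix.det hA
  rw [Matrix.det_mul, Matrix.det_mul, Matrix.det_diagonal] at h1
  have h2 : ∏ i, (if i = i₀ then (-1 : ℝ) else 1) ≠ 0 :=
    Finset.prod_ne_zero_iff.2 fun i _ => by split_ifs <;> norm_num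
  rw [isUnit_iff_ne_zero]
  rintro h0
  rw [h0] at h1
  simp only [mul_zero, zero_mul] at h1
  exact h2 h1.symm

/-- Transposing PᵀAP = D, with D diagonal, gives PᵀAᵀP = PᵀAP, and the invertible factors cancel. -/
lemma HasLorentzSignature.isSymm (h : HasLorentzSignature A) : A.IsSymm := by
  obtain ⟨P, i₀, hP, hA⟩ := h
  have hPt : IsUnit Pᵀ.det := by rwa [Matrix.det_transpose]
  have h1 : Pᵀ * (Aᵀ * P) = Pᵀ * (A * P) := by
    have := congrArg Matrix.transpose hA
    rw [Matrix.diagonal_transpose, Matrix.transpose_mul, Matrix.transpose_mul,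
      Matrix.transpose_transpose, ← hA] at this
    rw [this, Matrix.mul_assoc]
  have h2 : Aᵀ * P = A * P := by
    have := congrArg (fun B => Pᵀ⁻¹ * B) h1
    simpa only [Matrix.nonsing_inv_mul_cancel_left _ _ hPt] using this
  have := congrArg (fun B => B * P⁻¹) h2
  simp only [Matrix.mul_nonsing_inv_cancel_right _ _ hP] at this
  exact this

lemma sum_mul_sum_inv_mul (hA : IsUnit A.det) (b : Fin n → ℝ) (l : Fin n) :
    ∑ i, A l i * ∑ m, A⁻¹ i m * b m = b l := by
  have : A *ᵥ (A⁻¹ *ᵥ b) = b := by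
    rw [Matrix.mulVec_mulVec, Matrix.mul_nonsing_inv _ hA, Matrix.one_mulVec]
  exact congrFun this l

/-- The inverse is the adjugate divided by the determinant, both polynomial in the entries. -/
lemma contDiffOn_matrix_inv {Z : Type*} [NormedAddCommGroup Z] [NormedSpace ℝ Z] {Ω : Set Z}
    {A : Z → Matrix (Fin n) (Fin n) ℝ} (hs : ∀ i j, ContDiffOn ℝ ∞ (fun z => A z i j) Ω)
    (hA : ∀ z ∈ Ω, IsUnit (A z).det) (i j : Fin n) :
    ContDiffOn ℝ ∞ (fun z => (A z)⁻¹ i j) Ω := by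
  have hdet : ∀ {B : Z → Matrix (Fin n) (Fin n) ℝ},
      (∀ i j, ContDiffOn ℝ ∞ (fun z => B z i j) Ω) → ContDiffOn ℝ ∞ (fun z => (B z).det) Ω := by
    intro B hB
    simp only [Matrix.det_apply']
    exact ContDiffOn.sum fun σ _ => contDiffOn_const.mul (contDiffOn_prod fun k _ => hB _ _)
  have hadj : ContDiffOn ℝ ∞ (fun z => (A z).adjugate i j) Ω := by
    simp only [Matrix.adjugate_apply]
    refine hdet fun k m => ?_
    simp only [Matrix.updateRow_apply]
    split_ifs
    · exact contDiffOn_const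
    · exact hs k m
  simp only [Matrix.inv_def, Matrix.smul_apply, Ring.inverse_eq_inv', smul_eq_mul]
  exact ((hdet hs).inv fun z hz => (hA z hz).ne_zero).mul hadj

lemma sum_mul_christoffel {A : Coord n → Matrix (Fin n) (Fin n) ℝ} {x : Coord n}
    (hA : IsUnit (A x).det) (l j k : Fin n) :
    ∑ i, A x l i * christoffel A x i j k = (1 / 2) * (partialDeriv j (fun y => A y l k) x
      + partialDeriv k (fun y => A y j l) x - partialDeriv l (fun y => A y j k) x) := by
  rw [← sum_mul_sum_inv_mul hA (fun l => (1 / 2) * (partialDeriv j (fun y => A y l k) x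
      + partialDeriv k (fun y => A y j l) x - partialDeriv l (fun y => A y j k) x)) l]
  refine Finset.sum_congr rfl fun i _ => ?_
  rw [christoffel, Finset.mul_sum]
  congr 1
  exact Finset.sum_congr rfl fun m _ => by ring

lemma partialDeriv_congr {U : Set (Coord n)} (hU : IsOpen U) {f g : Coord n → ℝ}
    (h : Set.EqOn f g U) {x : Coord n} (hx : x ∈ U) (j : Fin n) :
    partialDeriv j f x = partialDeriv j g x :=
  dirDeriv_congr hU h hx _

lemma christoffel_symm {U : Set (Coord n)} (hU : IsOpen U)
    {A : Coord n → Matrix (Fin n) (Fin n) ℝ} (hA : ∀ y ∈ U, (A y).IsSymm) {x : Coord n}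
    (hx : x ∈ U) (i j k : Fin n) : christoffel A x i j k = christoffel A x i k j := by
  have h : ∀ l a b, partialDeriv l (fun y => A y a b) x = partialDeriv l (fun y => A y b a) x :=
    fun l a b => partialDeriv_congr hU (fun y hy => (hA y hy).apply b a) hx l
  unfold christoffel
  congr 1
  refine Finset.sum_congr rfl fun l _ => ?_
  rw [h j l k, h k j l, h l j k]
  ring

end Matrices

/-! ### Spray and Chern symbols of a Lorentz-Finsler structure in a chart -/

section FinslerSpray

variable {n : ℕ} {M : Type*} [TopologicalSpace M] [ChartedSpace (Coord n) M]
  {L : TangentBundle (𝓡 n) M → ℝ} {e : OpenPartialHomeomorph M (Coord n)}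

/-- The domain of the coordinates `(x, v)` of non-zero tangent vectors in a chart. -/
def slitDomain (e : OpenPartialHomeomorph M (Coord n)) : Set (Coord n × Coord n) :=
  e.target ×ˢ {0}ᶜ

/-- `L` in the coordinates `(x, v)`, as a function of one variable. -/
def chartLagrangian (L : TangentBundle (𝓡 n) M → ℝ) (e : OpenPartialHomeomorph M (Coord n))
    (p : Coord n × Coord n) : ℝ := localRep L e p.1 p.2

/-- The spray coefficients of `L` as functions of one variable. -/
def chartSpray (L : TangentBundle (𝓡 n) M → ℝ) (e : OpenPartialHomeomorph M (Coord n))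
    (i : Fin n) (p : Coord n × Coord n) : ℝ := spray L e i p.1 p.2

omit [ChartedSpace (Coord n) M] in
lemma isOpen_slitDomain : IsOpen (slitDomain e) := e.open_target.prod isOpen_compl_singleton

variable (hs : ContDiffOn ℝ ∞ (chartLagrangian L e) (slitDomain e)) {x v : Coord n}

include hs

lemma fundMatrix_eq (hp : (x, v) ∈ slitDomain e) (i j : Fin n) :
    fundMatrix L e x v i j = dV i (dV j (chartLagrangian L e)) (x, v) := by
  rw [fundMatrix, Matrix.of_apply]
  rw [← partialDeriv_right (f := dV j (chartLagrangian L e)) (differentiableAt_of_contDiffOn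
    isOpen_slitDomain (contDiffOn_dirDeriv isOpen_slitDomain hs _) hp)]
  refine partialDeriv_congr isOpen_compl_singleton (fun u hu => ?_) hp.2 i
  exact partialDeriv_right (f := chartLagrangian L e)
    (differentiableAt_of_contDiffOn isOpen_slitDomain hs
      (show (x, u) ∈ slitDomain e from ⟨hp.1, hu⟩)) j

lemma partialDeriv_fundMatrix_left (hp : (x, v) ∈ slitDomain e) (l i j : Fin n) :
    partialDeriv l (fun y => fundMatrix L e y v i j) x =
      dX l (dV i (dV j (chartLagrangian L e))) (x, v) := by
  have hO : IsOpen (slitDomain e) := isOpen_slitDomain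
  rw [← partialDeriv_left (f := dV i (dV j (chartLagrangian L e)))
    (differentiableAt_of_contDiffOn hO (contDiffOn_dirDeriv hO (contDiffOn_dirDeriv hO hs _) _) hp)]
  exact partialDeriv_congr e.open_target (fun y hy => fundMatrix_eq hs ⟨hy, hp.2⟩ i j) hp.1 l

lemma partialDeriv_fundMatrix_right (hp : (x, v) ∈ slitDomain e) (l i j : Fin n) :
    partialDeriv l (fun u => fundMatrix L e x u i j) v =
      dV l (dV i (dV j (chartLagrangian L e))) (x, v) := by
  have hO : IsOpen (slitDomain e) := isOpen_slitDomain
  rw [← partialDeriv_right (f := dV i (dV j (chartLagrangian L e)))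
    (differentiableAt_of_contDiffOn hO (contDiffOn_dirDeriv hO (contDiffOn_dirDeriv hO hs _) _) hp)]
  exact partialDeriv_congr isOpen_compl_singleton
    (fun u hu => fundMatrix_eq hs (show (x, u) ∈ slitDomain e from ⟨hp.1, hu⟩) i j) hp.2 l

variable [IsManifold (𝓡 n) ∞ M] (hL : IsLorentzFinsler L) (he : IsChart e)

include hL he

lemma isLocalLagrangian : IsLocalLagrangian (slitDomain e) (chartLagrangian L e) where
  isOpen := isOpen_slitDomain
  smooth := hs
  euler_eq := by
    rintro ⟨x, v⟩ hp
    have hd := (differentiableAt_of_contDiffOn isOpen_slitDomain hs hp).hasFDerivAt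
    -- Euler's identity is the derivative at c = 1 of L(x, cv) = c² L(x, v).
    have h1 : HasDerivAt (fun c : ℝ => ((x, c • v) : Coord n × Coord n)) (0, v) 1 := by
      have := (hasDerivAt_id (1 : ℝ)).smul_const v
      rw [one_smul] at this
      exact (hasDerivAt_const (1 : ℝ) x).prodMk this
    have h2 : HasDerivAt (fun c : ℝ => chartLagrangian L e (x, c • v))
        (fderiv ℝ (chartLagrangian L e) (x, v) (0, v)) 1 := by
      refine HasFDerivAt.comp_hasDerivAt (l := chartLagrangian L e)
        (f := fun c : ℝ => ((x, c • v) : Coord n × Coord n)) (1 : ℝ) ?_ h1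
      simpa using hd
    have h3 : HasDerivAt (fun c : ℝ => c ^ 2 * chartLagrangian L e (x, v))
        (2 * chartLagrangian L e (x, v)) 1 := by
      have := (hasDerivAt_pow 2 (1 : ℝ)).mul_const (chartLagrangian L e (x, v))
      simpa using this
    rw [euler_eq_dirDeriv]
    refine h2.unique (h3.congr_of_eventuallyEq ?_)
    filter_upwards [lt_mem_nhds (zero_lt_one (α := ℝ))] with c hc
    have := hL.homogeneous (e.symm x) (ofCoord e x v) c hc
    rw [chartLagrangian, chartLagrangian, localRep, localRep, ← this]
    exact congrArg (fun w => L ⟨e.symm x, w⟩) (map_smul (mfderiv (𝓡 n) (𝓡 n) e.symm x) c v)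
  nondegenerate := by
    rintro ⟨x, v⟩ hp
    have := (hL.lorentzian e he x hp.1 v hp.2).isUnit_det
    convert this using 3
    ext i j
    exact (fundMatrix_eq hs hp i j).symm

lemma contDiffOn_inv_fundMatrix (i j : Fin n) :
    ContDiffOn ℝ ∞ (fun p : Coord n × Coord n => (fundMatrix L e p.1 p.2)⁻¹ i j)
      (slitDomain e) := by
  have S := isLocalLagrangian hs hL he
  refine contDiffOn_matrix_inv (fun a b => ?_) (fun p hp =>
    (hL.lorentzian e he p.1 hp.1 p.2 hp.2).isUnit_det) i j
  exact (S.smooth_dVdV a b).congr fun p hp => fundMatrix_eq hs hp a b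

lemma contDiffOn_formalChristoffel (i j k : Fin n) :
    ContDiffOn ℝ ∞ (fun p : Coord n × Coord n => formalChristoffel L e p.1 p.2 i j k)
      (slitDomain e) := by
  have S := isLocalLagrangian hs hL he
  have h : ∀ l a b, ContDiffOn ℝ ∞ (dX l (dV a (dV b (chartLagrangian L e)))) (slitDomain e) :=
    fun l a b => contDiffOn_dirDeriv S.isOpen (S.smooth_dVdV a b) _
  have h1 : ContDiffOn ℝ ∞ (fun p : Coord n × Coord n => (1 / 2) * ∑ l,
      (fundMatrix L e p.1 p.2)⁻¹ i l * (dX j (dV l (dV k (chartLagrangian L e))) p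
        + dX k (dV j (dV l (chartLagrangian L e))) p
        - dX l (dV j (dV k (chartLagrangian L e))) p)) (slitDomain e) :=
    contDiffOn_const.mul (ContDiffOn.sum fun l _ =>
      (contDiffOn_inv_fundMatrix hs hL he i l).mul (((h _ _ _).add (h _ _ _)).sub (h _ _ _)))
  refine h1.congr fun p hp => ?_
  simp only [formalChristoffel, christoffel]
  congr 1
  refine Finset.sum_congr rfl fun l _ => ?_
  rw [partialDeriv_fundMatrix_left hs hp, partialDeriv_fundMatrix_left hs hp,
    partialDeriv_fundMatrix_left hs hp]

lemma isLocalSpray : IsLocalSpray (slitDomain e) (chartLagrangian L e) (chartSpray L e) where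
  toIsLocalLagrangian := isLocalLagrangian hs hL he
  smooth_spray i := by
    unfold chartSpray spray
    exact ContDiffOn.sum fun j _ => ContDiffOn.sum fun k _ =>
    ((contDiffOn_formalChristoffel hs hL he i j k).mul (contDiff_snd_apply j).contDiffOn).mul
      (contDiff_snd_apply k).contDiffOn
  lagrange := by
    rintro ⟨x, v⟩ hp l
    have S := isLocalLagrangian hs hL he
    set F := chartLagrangian L e with hF
    -- Lower the index of γ and contract with v^j v^k. Homogeneity collapses each of the three
    -- double sums: the first two give v^k ∂_{x^k}∂_{v^l} F, the third 2 ∂_{x^l} F.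
    have hγ : ∀ j k, ∑ i, dV l (dV i F) (x, v) * formalChristoffel L e x v i j k =
        (1 / 2) * (dX j (dV l (dV k F)) (x, v) + dX k (dV j (dV l F)) (x, v)
          - dX l (dV j (dV k F)) (x, v)) := by
      intro j k
      have := sum_mul_christoffel (A := fun y => fundMatrix L e y v) (x := x)
        (hL.lorentzian e he x hp.1 v hp.2).isUnit_det l j k
      rw [partialDeriv_fundMatrix_left hs hp, partialDeriv_fundMatrix_left hs hp,
        partialDeriv_fundMatrix_left hs hp] at this
      rw [← this]
      exact Finset.sum_congr rfl fun i _ => by rw [fundMatrix_eq hs hp]; rfl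
    have h1 : ∑ i, dV l (dV i F) (x, v) * chartSpray L e i (x, v) =
        ∑ j, ∑ k, (∑ i, dV l (dV i F) (x, v) * formalChristoffel L e x v i j k) * v j * v k := by
      simp only [chartSpray, spray, Finset.mul_sum, Finset.sum_mul]
      rw [Finset.sum_comm]
      refine Finset.sum_congr rfl fun j _ => ?_
      rw [Finset.sum_comm]
      exact Finset.sum_congr rfl fun k _ => Finset.sum_congr rfl fun i _ => by ring
    have e1 : ∑ j, ∑ k, dX j (dV l (dV k F)) (x, v) * v j * v k =
        ∑ k, v k * dX k (dV l F) (x, v) := by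
      refine Finset.sum_congr rfl fun j _ => ?_
      rw [← S.euler_dXdV_eq hp j l, Finset.mul_sum]
      refine Finset.sum_congr rfl fun k _ => ?_
      have : dX j (dV l (dV k F)) (x, v) = dX j (dV k (dV l F)) (x, v) :=
        S.dirDeriv_dVdV_comm hp _ l k
      rw [this]; ring
    have e2 : ∑ j, ∑ k, dX k (dV j (dV l F)) (x, v) * v j * v k =
        ∑ k, v k * dX k (dV l F) (x, v) := by
      rw [Finset.sum_comm]
      refine Finset.sum_congr rfl fun k _ => ?_
      rw [← S.euler_dXdV_eq hp k l, Finset.mul_sum]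
      exact Finset.sum_congr rfl fun j _ => by ring
    have e3 : ∑ j, ∑ k, dX l (dV j (dV k F)) (x, v) * v j * v k = 2 * dX l F (x, v) := by
      rw [← S.euler_dX_eq hp l, Finset.sum_comm]
      refine Finset.sum_congr rfl fun k _ => ?_
      rw [← S.euler_dXdV_eq hp l k, Finset.mul_sum]
      exact Finset.sum_congr rfl fun j _ => by ring
    have h2 : ∑ j, ∑ k, (∑ i, dV l (dV i F) (x, v) * formalChristoffel L e x v i j k) * v j * v k =
        (1 / 2) * (∑ j, ∑ k, dX j (dV l (dV k F)) (x, v) * v j * v k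
          + ∑ j, ∑ k, dX k (dV j (dV l F)) (x, v) * v j * v k
          - ∑ j, ∑ k, dX l (dV j (dV k F)) (x, v) * v j * v k) := by
      simp only [hγ, ← Finset.sum_add_distrib, ← Finset.sum_sub_distrib, Finset.mul_sum]
      exact Finset.sum_congr rfl fun j _ => Finset.sum_congr rfl fun k _ => by ring
    rw [h1, h2, e1, e2, e3]
    ring

lemma nonlinearConn_eq (hp : (x, v) ∈ slitDomain e) (i j : Fin n) :
    nonlinearConn L e x v i j = sprayConn (chartSpray L e) i j (x, v) := by
  have S := isLocalSpray hs hL he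
  rw [nonlinearConn, if_neg (show v ≠ 0 from hp.2), sprayConn,
    ← partialDeriv_right (f := chartSpray L e i)
      (differentiableAt_of_contDiffOn S.isOpen (S.smooth_spray i) hp)]
  rfl

/-- The correction terms in the definition of Γ are exactly what turns each ∂/∂x^j in γ into the
horizontal derivative δ_j. -/
lemma chernSymbol_eq (hp : (x, v) ∈ slitDomain e) (i j k : Fin n) :
    chernSymbol L e x v i j k = ∑ l, (fundMatrix L e x v)⁻¹ i l *
      loweredChern (chartLagrangian L e) (chartSpray L e) l j k (x, v) := by
  have S := isLocalSpray hs hL he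
  rw [chernSymbol, formalChristoffel, christoffel, ← mul_sub, ← Finset.sum_sub_distrib,
    Finset.mul_sum]
  refine Finset.sum_congr rfl fun l _ => ?_
  rw [partialDeriv_fundMatrix_left hs hp, partialDeriv_fundMatrix_left hs hp,
    partialDeriv_fundMatrix_left hs hp, ← Finset.mul_sum]
  simp only [partialDeriv_fundMatrix_right hs hp, nonlinearConn_eq hs hL he hp,
    loweredChern, horizDeriv, Finset.sum_add_distrib, Finset.sum_sub_distrib]
  simp only [mul_comm (dV _ (dV _ (dV _ _)) _)]
  ring

lemma contDiffOn_chernSymbol (i j k : Fin n) :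
    ContDiffOn ℝ ∞ (fun p : Coord n × Coord n => chernSymbol L e p.1 p.2 i j k)
      (slitDomain e) := by
  have S := isLocalSpray hs hL he
  have h : ∀ a b c, ContDiffOn ℝ ∞
      (horizDeriv (chartSpray L e) a (dV b (dV c (chartLagrangian L e)))) (slitDomain e) :=
    fun a b c => (contDiffOn_dirDeriv S.isOpen (S.smooth_dVdV b c) _).sub
      (ContDiffOn.sum fun m _ => (S.smooth_sprayConn m a).mul
        (contDiffOn_dirDeriv S.isOpen (S.smooth_dVdV b c) _))
  refine ContDiffOn.congr (ContDiffOn.sum fun l _ =>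
    (contDiffOn_inv_fundMatrix hs hL he i l).mul (contDiffOn_const (c := (1 / 2 : ℝ)).mul
      (((h j l k).add (h k j l)).sub (h l j k)))) fun p hp => chernSymbol_eq hs hL he hp i j k

lemma sum_fundMatrix_mul_chernSymbol (hp : (x, v) ∈ slitDomain e) (l j k : Fin n) :
    ∑ i, fundMatrix L e x v l i * chernSymbol L e x v i j k =
      loweredChern (chartLagrangian L e) (chartSpray L e) l j k (x, v) := by
  simp only [chernSymbol_eq hs hL he hp]
  exact sum_mul_sum_inv_mul (hL.lorentzian e he x hp.1 v hp.2).isUnit_det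
    (fun l => loweredChern (chartLagrangian L e) (chartSpray L e) l j k (x, v)) l

lemma sum_chernSymbol_mul (hp : (x, v) ∈ slitDomain e) (i j : Fin n) :
    ∑ k, chernSymbol L e x v i j k * v k = sprayConn (chartSpray L e) i j (x, v) := by
  have S := isLocalSpray hs hL he
  refine congrFun (sum_mul_injective (hL.lorentzian e he x hp.1 v hp.2).isUnit_det
    (c := fun i => ∑ k, chernSymbol L e x v i j k * v k)
    (d := fun i => sprayConn (chartSpray L e) i j (x, v)) fun l => ?_) i
  have h : ∑ i, fundMatrix L e x v l i * ∑ k, chernSymbol L e x v i j k * v k =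
      ∑ k, (∑ i, fundMatrix L e x v l i * chernSymbol L e x v i j k) * v k := by
    simp only [Finset.mul_sum, Finset.sum_mul]
    rw [Finset.sum_comm]
    exact Finset.sum_congr rfl fun k _ => Finset.sum_congr rfl fun i _ => by ring
  rw [h]
  simp only [sum_fundMatrix_mul_chernSymbol hs hL he hp]
  simp only [fundMatrix_eq hs hp]
  exact S.sum_loweredChern_mul hp l j

lemma chernSymbol_symm (hp : (x, v) ∈ slitDomain e) (i j k : Fin n) :
    chernSymbol L e x v i j k = chernSymbol L e x v i k j := by
  have S := isLocalSpray hs hL he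
  have h : ∀ a b c, horizDeriv (chartSpray L e) a (dV b (dV c (chartLagrangian L e))) (x, v) =
      horizDeriv (chartSpray L e) a (dV c (dV b (chartLagrangian L e))) (x, v) := by
    intro a b c
    have h1 : ∀ m, dV m (dV b (dV c (chartLagrangian L e))) (x, v) =
        dV m (dV c (dV b (chartLagrangian L e))) (x, v) := fun m => S.dirDeriv_dVdV_comm hp _ b c
    simp only [horizDeriv, h1]
    congr 1
    exact S.dirDeriv_dVdV_comm hp _ b c
  rw [chernSymbol_eq hs hL he hp, chernSymbol_eq hs hL he hp]
  refine Finset.sum_congr rfl fun l _ => ?_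
  rw [loweredChern, loweredChern, h j l k, h k j l, h l j k]
  ring

end FinslerSpray

/-! ### A spray whose nonlinear connection preserves a metric -/

section MetricSpray

variable {n : ℕ}

lemma dirDeriv_coord (k c : Fin n) (v : Coord n) :
    dirDeriv (coordVec c) (fun u : Coord n => u k) v = if k = c then 1 else 0 := by
  have : HasFDerivAt (fun u : Coord n => u k) (EuclideanSpace.proj k : Coord n →L[ℝ] ℝ) v :=
    (EuclideanSpace.proj k : Coord n →L[ℝ] ℝ).hasFDerivAt
  simp [dirDeriv, this.fderiv, coordVec]

lemma dirDeriv_const_fun {Z : Type*} [NormedAddCommGroup Z] [NormedSpace ℝ Z] (w : Z) (a : ℝ)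
    (z : Z) : dirDeriv w (fun _ => a) z = 0 := by
  simp [dirDeriv]

lemma differentiableAt_coord (k : Fin n) (v : Coord n) :
    DifferentiableAt ℝ (fun u : Coord n => u k) v :=
  (EuclideanSpace.proj k : Coord n →L[ℝ] ℝ).differentiableAt

lemma dirDeriv_linear (b : Fin n → ℝ) (c : Fin n) (v : Coord n) :
    dirDeriv (coordVec c) (fun u : Coord n => ∑ k, u k * b k) v = b c := by
  rw [dirDeriv_sum_mul (b := fun k _ => b k) (fun k => differentiableAt_coord k v)
    (fun k => differentiableAt_const _)]
  simp [dirDeriv_coord, dirDeriv_const_fun]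

variable {G : Fin n → Coord n → ℝ} {N : Fin n → Fin n → Coord n → ℝ}
  {h : Fin n → Fin n → ℝ} {dh : Fin n → Fin n → Fin n → ℝ}

/-- If the non-linear connection `N^i_j = ½ ∂G^i/∂v^j` of a `2`-homogeneous spray preserves a
bilinear form `h` with derivative `dh l = ∂_l h`, then `G` is the spray of `h`. -/
lemma sum_mul_spray_of_preserved
    (hG : ∀ i, ∀ v ≠ 0, DifferentiableAt ℝ (G i) v)
    (hN : ∀ i j, ∀ v ≠ 0, partialDeriv j (G i) v = 2 * N i j v)
    (hNG : ∀ i, ∀ v ≠ 0, ∑ j, N i j v * v j = G i v)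
    (hsymm : ∀ i j, h i j = h j i) (dhsymm : ∀ l i j, dh l i j = dh l j i)
    (hpar : ∀ v : Coord n, v ≠ 0 → ∀ j k,
      ∑ l, v l * dh l j k = ∑ a, (h a k * N a j v + h j a * N a k v))
    {v : Coord n} (hv : v ≠ 0) (c : Fin n) :
    ∑ a, h c a * G a v = ∑ k, v k * ∑ l, v l * dh l c k
      - (1 / 2) * ∑ j, v j * ∑ k, v k * dh c j k := by
  -- Full contraction of the compatibility identity. It holds on the whole slit space, so it may be
  -- differentiated in v^c.
  have hid : ∀ u ∈ ({0}ᶜ : Set (Coord n)), ∑ j, u j * ∑ k, u k * ∑ l, u l * dh l j k =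
      2 * ∑ k, u k * ∑ a, G a u * h a k := by
    intro u hu
    have e1 : ∑ k, u k * ∑ j, u j * ∑ a, h a k * N a j u = ∑ k, u k * ∑ a, G a u * h a k := by
      refine Finset.sum_congr rfl fun k _ => ?_
      congr 1
      simp_rw [← hNG _ u hu, Finset.mul_sum, Finset.sum_mul]
      rw [Finset.sum_comm]
      exact Finset.sum_congr rfl fun a _ => Finset.sum_congr rfl fun j _ => by ring
    have e2 : ∑ j, u j * ∑ k, u k * ∑ a, h j a * N a k u = ∑ k, u k * ∑ a, G a u * h a k := by
      rw [← e1]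
      refine Finset.sum_congr rfl fun k _ => ?_
      congr 1
      refine Finset.sum_congr rfl fun j _ => ?_
      congr 1
      exact Finset.sum_congr rfl fun a _ => by rw [hsymm]
    have e3 : ∑ j, u j * ∑ k, u k * ∑ a, h a k * N a j u = ∑ k, u k * ∑ a, G a u * h a k := by
      rw [← e1]
      simp_rw [Finset.mul_sum]
      rw [Finset.sum_comm]
      exact Finset.sum_congr rfl fun k _ => Finset.sum_congr rfl fun j _ =>
        Finset.sum_congr rfl fun a _ => by ring
    simp only [hpar u hu, Finset.sum_add_distrib, mul_add]
    rw [e2, e3]; ring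
  have hc : ∀ k, DifferentiableAt ℝ (fun u : Coord n => u k) v :=
    fun k => differentiableAt_coord k v
  have hl : ∀ b : Fin n → ℝ, DifferentiableAt ℝ (fun u : Coord n => ∑ l, u l * b l) v :=
    fun b => differentiableAt_sum_mul (b := fun k _ => b k) hc fun _ => differentiableAt_const _
  have hq : ∀ j, DifferentiableAt ℝ (fun u : Coord n => ∑ k, u k * ∑ l, u l * dh l j k) v :=
    fun j => differentiableAt_sum_mul hc fun k => hl _
  have hg : ∀ k, DifferentiableAt ℝ (fun u : Coord n => ∑ a, G a u * h a k) v :=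
    fun k => differentiableAt_sum_mul (b := fun a _ => h a k) (fun a => hG a v hv)
      fun _ => differentiableAt_const _
  have hd := dirDeriv_congr isOpen_compl_singleton hid hv (coordVec c)
  rw [dirDeriv_const_mul (differentiableAt_sum_mul hc hg), dirDeriv_sum_mul hc hg,
    dirDeriv_sum_mul hc hq] at hd
  have hq' : ∀ j, dirDeriv (coordVec c) (fun u : Coord n => ∑ k, u k * ∑ l, u l * dh l j k) v =
      ∑ l, v l * dh l j c + ∑ k, v k * dh c j k := by
    intro j
    rw [dirDeriv_sum_mul hc (fun k => hl _)]
    simp only [dirDeriv_linear, dirDeriv_coord, Finset.sum_add_distrib, ite_mul, one_mul, zero_mul,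
      Finset.sum_ite_eq', Finset.mem_univ, if_true]
  have hg' : ∀ k, dirDeriv (coordVec c) (fun u : Coord n => ∑ a, G a u * h a k) v =
      2 * ∑ a, h a k * N a c v := by
    intro k
    rw [dirDeriv_sum_mul (b := fun a _ => h a k) (fun a => hG a v hv)
      (fun _ => differentiableAt_const _), Finset.mul_sum]
    refine Finset.sum_congr rfl fun a _ => ?_
    rw [dirDeriv_const_fun]
    have := hN a c v hv
    unfold partialDeriv at this
    unfold dirDeriv
    rw [this]; ring
  simp only [hq', hg', dirDeriv_coord, Finset.sum_add_distrib, ite_mul, one_mul, zero_mul,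
      Finset.sum_ite_eq', Finset.mem_univ, if_true, mul_add] at hd
  -- Compatibility contracted with only one further v. It expresses the sum v^k h_{ak} N^a_c, the
  -- one unwanted term in `hd`, through h_{ca} G^a and derivatives of h.
  have hA : ∑ k, v k * ∑ l, v l * dh l c k =
      ∑ k, v k * ∑ a, h a k * N a c v + ∑ a, h c a * G a v := by
    simp only [hpar v hv, Finset.sum_add_distrib, mul_add]
    congr 1
    simp_rw [← hNG _ v hv, Finset.mul_sum]
    rw [Finset.sum_comm]
    exact Finset.sum_congr rfl fun a _ => Finset.sum_congr rfl fun j _ => by ring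
  have hA' : ∑ j, v j * ∑ l, v l * dh l j c = ∑ k, v k * ∑ l, v l * dh l c k := by
    simp only [dhsymm _ _ c]
  have hH : ∑ a, G a v * h a c = ∑ a, h c a * G a v :=
    Finset.sum_congr rfl fun a _ => by rw [hsymm]; ring
  have hX : ∑ k, v k * (2 * ∑ a, h a k * N a c v) = 2 * ∑ k, v k * ∑ a, h a k * N a c v := by
    rw [Finset.mul_sum]; exact Finset.sum_congr rfl fun k _ => by ring
  rw [hA', hH, hX] at hd
  linarith

end MetricSpray

/-! ### Chern symbols of a quadratic spray -/

section Comparison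

variable {n : ℕ} {M : Type*} [TopologicalSpace M] [ChartedSpace (Coord n) M]
  [IsManifold (𝓡 n) ∞ M] {L : TangentBundle (𝓡 n) M → ℝ}
  {e : OpenPartialHomeomorph M (Coord n)} {x v : Coord n}

/-- If the spray of `L` is quadratic in `v` at the point `x`, then its coefficients are the Chern
symbols. -/
lemma chernSymbol_of_quadratic (hs : ContDiffOn ℝ ∞ (chartLagrangian L e) (slitDomain e))
    (hL : IsLorentzFinsler L) (he : IsChart e) (hx : x ∈ e.target)
    {C : Fin n → Fin n → Fin n → ℝ} (hC : ∀ i j k, C i j k = C i k j)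
    (hG : ∀ u ≠ 0, ∀ i, chartSpray L e i (x, u) = ∑ j, u j * ∑ k, u k * C i j k)
    (hv : v ≠ 0) (i j k : Fin n) : chernSymbol L e x v i j k = C i j k := by
  have S := isLocalSpray hs hL he
  have hp : ∀ {u : Coord n}, u ≠ 0 → (x, u) ∈ slitDomain e := fun hu => ⟨hx, hu⟩
  -- Quadratic G makes N linear in v: its first vertical derivatives are C and its second ones
  -- vanish.
  have hN : ∀ u ≠ 0, ∀ i j, sprayConn (chartSpray L e) i j (x, u) = ∑ k, u k * C i j k := by
    intro u hu i j
    have hc : ∀ k, DifferentiableAt ℝ (fun u : Coord n => u k) u :=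
      fun k => differentiableAt_coord k u
    have hl : ∀ b : Fin n → ℝ, DifferentiableAt ℝ (fun u : Coord n => ∑ l, u l * b l) u :=
      fun b => differentiableAt_sum_mul (b := fun k _ => b k) hc fun _ => differentiableAt_const _
    rw [sprayConn, ← partialDeriv_right (differentiableAt_of_contDiffOn S.isOpen
      (S.smooth_spray i) (hp hu)), partialDeriv_congr isOpen_compl_singleton
      (fun w hw => hG w hw i) hu]
    change 1 / 2 * dirDeriv (coordVec j) _ u = _
    rw [dirDeriv_sum_mul hc (fun k => hl _)]
    simp only [dirDeriv_linear, dirDeriv_coord, Finset.sum_add_distrib, ite_mul, one_mul, zero_mul,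
      Finset.sum_ite_eq', Finset.mem_univ, if_true, hC i _ j]
    ring
  have hB : ∀ u ≠ 0, ∀ m j a, dV a (sprayConn (chartSpray L e) m j) (x, u) = C m j a := by
    intro u hu m j a
    rw [← partialDeriv_right (differentiableAt_of_contDiffOn S.isOpen
      (S.smooth_sprayConn m j) (hp hu)), partialDeriv_congr isOpen_compl_singleton
      (fun w hw => hN w hw m j) hu]
    exact dirDeriv_linear _ _ _
  have hB' : ∀ m j a b, dV b (dV a (sprayConn (chartSpray L e) m j)) (x, v) = 0 := by
    intro m j a b
    rw [← partialDeriv_right (f := dV a (sprayConn (chartSpray L e) m j))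
      (differentiableAt_of_contDiffOn S.isOpen
        (contDiffOn_dirDeriv S.isOpen (S.smooth_sprayConn m j) _) (hp hv)),
      partialDeriv_congr isOpen_compl_singleton (fun w hw => hB w hw m j a) hv]
    exact dirDeriv_const_fun _ _ _
  refine congrFun (sum_mul_injective (hL.lorentzian e he x hx v hv).isUnit_det
    (c := fun i => chernSymbol L e x v i j k) (d := fun i => C i j k) fun l => ?_) i
  rw [sum_fundMatrix_mul_chernSymbol hs hL he (hp hv),
    S.loweredChern_of_linear (hp hv) C hC (hB v hv) hB']
  exact Finset.sum_congr rfl fun m _ => by rw [fundMatrix_eq hs (hp hv)]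

/-- If `h` is a field of non-degenerate matrices on the chart domain that is preserved by the
non-linear connection of `L` at the point `x`, then the Chern symbols of `L` at `x` are the
Christoffel symbols of `h`. -/
lemma chernSymbol_eq_christoffel (hs : ContDiffOn ℝ ∞ (chartLagrangian L e) (slitDomain e))
    (hL : IsLorentzFinsler L) (he : IsChart e) (hx : x ∈ e.target)
    {h : Coord n → Matrix (Fin n) (Fin n) ℝ} (hsymm : ∀ y ∈ e.target, (h y).IsSymm)
    (hdet : IsUnit (h x).det)
    (hpar : ∀ v : Coord n, v ≠ 0 → ∀ j k, ∑ l, v l * partialDeriv l (fun y => h y j k) x =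
      ∑ a, (h x a k * sprayConn (chartSpray L e) a j (x, v)
        + h x j a * sprayConn (chartSpray L e) a k (x, v)))
    (hv : v ≠ 0) (i j k : Fin n) : chernSymbol L e x v i j k = christoffel h x i j k := by
  have S := isLocalSpray hs hL he
  have hp : ∀ {u : Coord n}, u ≠ 0 → (x, u) ∈ slitDomain e := fun hu => ⟨hx, hu⟩
  have hd : ∀ i, ∀ u ≠ 0, DifferentiableAt ℝ (chartSpray L e i) (x, u) := fun i u hu =>
    differentiableAt_of_contDiffOn S.isOpen (S.smooth_spray i) (hp hu)
  refine chernSymbol_of_quadratic hs hL he hx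
    (fun i j k => christoffel_symm e.open_target hsymm hx i j k) (fun u hu i => ?_) hv i j k
  refine congrFun (sum_mul_injective hdet (c := fun i => chartSpray L e i (x, u))
    (d := fun i => ∑ j, u j * ∑ k, u k * christoffel h x i j k) fun c => ?_) i
  rw [sum_mul_spray_of_preserved (G := fun i u => chartSpray L e i (x, u))
    (N := fun i j u => sprayConn (chartSpray L e) i j (x, u))
    (h := h x) (dh := fun l j k => partialDeriv l (fun y => h y j k) x)
    (fun i u hu => (hd i u hu).comp u (differentiableAt_const x |>.prodMk differentiableAt_id))
    (fun i j u hu => by rw [partialDeriv_right (hd i u hu), sprayConn]; ring)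
    (fun i u hu => S.sum_sprayConn_mul (hp hu) i)
    (fun i j => (hsymm x hx).apply j i)
    (fun l i j => partialDeriv_congr e.open_target (fun y hy => (hsymm y hy).apply j i) hx l)
    hpar hu c]
  have h1 : ∑ i, h x c i * ∑ j, u j * ∑ k, u k * christoffel h x i j k =
      ∑ j, ∑ k, u j * u k * ∑ i, h x c i * christoffel h x i j k := by
    simp only [Finset.mul_sum]
    rw [Finset.sum_comm]
    refine Finset.sum_congr rfl fun j _ => ?_
    rw [Finset.sum_comm]
    exact Finset.sum_congr rfl fun k _ => Finset.sum_congr rfl fun i _ => by ring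
  have e1 : ∑ k, u k * ∑ l, u l * partialDeriv l (fun y => h y c k) x =
      ∑ j, ∑ k, u j * u k * partialDeriv j (fun y => h y c k) x := by
    simp only [Finset.mul_sum]
    rw [Finset.sum_comm]
    exact Finset.sum_congr rfl fun j _ => Finset.sum_congr rfl fun k _ => by ring
  have e2 : ∑ k, u k * ∑ l, u l * partialDeriv l (fun y => h y c k) x =
      ∑ j, ∑ k, u j * u k * partialDeriv k (fun y => h y j c) x := by
    simp only [Finset.mul_sum]
    refine Finset.sum_congr rfl fun j _ => Finset.sum_congr rfl fun k _ => ?_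
    rw [partialDeriv_congr e.open_target (fun y hy => (hsymm y hy).apply j c) hx k]
    ring
  have e3 : ∑ j, u j * ∑ k, u k * partialDeriv c (fun y => h y j k) x =
      ∑ j, ∑ k, u j * u k * partialDeriv c (fun y => h y j k) x := by
    simp only [Finset.mul_sum]
    exact Finset.sum_congr rfl fun j _ => Finset.sum_congr rfl fun k _ => by ring
  have h2 : ∑ j, ∑ k, u j * u k * ∑ i, h x c i * christoffel h x i j k =
      (1 / 2) * (∑ j, ∑ k, u j * u k * partialDeriv j (fun y => h y c k) x
        + ∑ j, ∑ k, u j * u k * partialDeriv k (fun y => h y j c) x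
        - ∑ j, ∑ k, u j * u k * partialDeriv c (fun y => h y j k) x) := by
    simp only [sum_mul_christoffel hdet, ← Finset.sum_add_distrib, ← Finset.sum_sub_distrib]
    simp only [Finset.mul_sum]
    exact Finset.sum_congr rfl fun j _ => Finset.sum_congr rfl fun k _ => by ring
  rw [h1, h2, ← e1, ← e2, ← e3]
  ring

end Comparison

/-! ### Smoothness of coordinate expressions -/

section Charts

variable {n : ℕ} {M : Type*} [TopologicalSpace M] [ChartedSpace (Coord n) M]
  {e : OpenPartialHomeomorph M (Coord n)} {x v : Coord n}

lemma IsChart.mdifferentiable (he : IsChart e) : e.MDifferentiable (𝓡 n) (𝓡 n) :=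
  ⟨(contMDiffOn_of_mem_maximalAtlas he).mdifferentiableOn (by simp),
    (contMDiffOn_symm_of_mem_maximalAtlas he).mdifferentiableOn (by simp)⟩

lemma toCoord_ofCoord (he : IsChart e) (hx : x ∈ e.target) (v : Coord n) :
    toCoord e (e.symm x) (ofCoord e x v) = v :=
  congrArg (fun T : Coord n →L[ℝ] Coord n => T v) (he.mdifferentiable.comp_symm_deriv hx)

lemma ofCoord_ne_zero (he : IsChart e) (hx : x ∈ e.target) (hv : v ≠ 0) : ofCoord e x v ≠ 0 := by
  intro h
  apply hv
  rw [← toCoord_ofCoord he hx v, h]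
  exact map_zero (mfderiv (𝓡 n) (𝓡 n) e (e.symm x))

variable [IsManifold (𝓡 n) ∞ M]

/-- The coordinate parametrization of the tangent bundle is smooth. -/
lemma contMDiffOn_ofCoord (he : IsChart e) :
    ContMDiffOn 𝓘(ℝ, Coord n × Coord n) (𝓡 n).tangent ∞
      (fun p => (⟨e.symm p.1, ofCoord e p.1 p.2⟩ : TangentBundle (𝓡 n) M))
      (e.target ×ˢ Set.univ) := by
  have : IsManifold (𝓡 n) 1 M := IsManifold.of_le (n := ∞) (by simp)
  have h1 : ContMDiff 𝓘(ℝ, Coord n × Coord n) (𝓡 n).tangent ∞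
      (fun p : Coord n × Coord n => (⟨p.1, p.2⟩ : TangentBundle (𝓡 n) (Coord n))) := by
    intro p
    refine Bundle.contMDiffAt_totalSpace.2 ⟨contDiff_fst.contMDiff p, ?_⟩
    simpa using contDiff_snd.contMDiff p
  have h2 := (contMDiffOn_symm_of_mem_maximalAtlas he).contMDiffOn_tangentMapWithin
    (m := ∞) (by simp) e.open_target.uniqueMDiffOn
  refine (h2.comp h1.contMDiffOn (fun p hp => hp.1)).congr fun p hp => ?_
  simp only [Function.comp, tangentMapWithin, ofCoord]
  rw [mfderivWithin_of_isOpen e.open_target hp.1]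

lemma contDiffOn_chartLagrangian {L : TangentBundle (𝓡 n) M → ℝ} (hL : IsLorentzFinsler L)
    (he : IsChart e) : ContDiffOn ℝ ∞ (chartLagrangian L e) (slitDomain e) := by
  rw [← contMDiffOn_iff_contDiffOn]
  exact hL.smooth.comp ((contMDiffOn_ofCoord he).mono
    (Set.prod_mono subset_rfl (Set.subset_univ _))) fun p hp => ofCoord_ne_zero he hp.1 hp.2

lemma contDiffOn_metricMatrix
    {g : (x : M) → TangentSpace (𝓡 n) x →L[ℝ] TangentSpace (𝓡 n) x →L[ℝ] ℝ}
    (hg : IsLorentzMetric g) (he : IsChart e) (i j : Fin n) :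
    ContDiffOn ℝ ∞ (fun y => metricMatrix g e y i j) e.target := by
  rw [← contMDiffOn_iff_contDiffOn]
  have hv : ∀ w : Coord n, ContMDiffOn (𝓡 n) (𝓡 n).tangent ∞
      (fun y => (⟨e.symm y, ofCoord e y w⟩ : TangentBundle (𝓡 n) M)) e.target := fun w =>
    (contMDiffOn_ofCoord he).comp
      (f := fun y : Coord n => (y, w)) (s := e.target)
      ((contDiff_id.prodMk contDiff_const).contMDiff.contMDiffOn) fun y hy => ⟨hy, trivial⟩
  have hgb := hg.smooth.comp_contMDiffOn (contMDiffOn_symm_of_mem_maximalAtlas he)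
  have h : ContMDiffOn (𝓡 n) ((𝓡 n).prod 𝓘(ℝ)) ∞
      (fun y => Bundle.TotalSpace.mk' ℝ (E := Bundle.Trivial M ℝ) (e.symm y)
        (g (e.symm y) (ofCoord e y (coordVec i)) (ofCoord e y (coordVec j)))) e.target := by
    exact ContMDiffOn.clm_bundle_apply₂ (F₁ := Coord n) (F₂ := Coord n) (F₃ := ℝ)
      (b := e.symm) (E₁ := fun x : M => TangentSpace (𝓡 n) x)
      (E₂ := fun x : M => TangentSpace (𝓡 n) x) (E₃ := Bundle.Trivial M ℝ)
      (ψ := fun y => g (e.symm y)) hgb (hv _) (hv _)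
  intro y hy
  have := h y hy
  simp only [Bundle.contMDiffWithinAt_totalSpace] at this
  exact this.2

omit [IsManifold (𝓡 n) ∞ M] in
/-- A bilinear form in terms of its matrix. -/
lemma apply_ofCoord (g : (x : M) → TangentSpace (𝓡 n) x →L[ℝ] TangentSpace (𝓡 n) x →L[ℝ] ℝ)
    (e : OpenPartialHomeomorph M (Coord n)) (x v w : Coord n) :
    g (e.symm x) (ofCoord e x v) (ofCoord e x w) =
      ∑ i, ∑ j, metricMatrix g e x i j * v i * w j := by
  have h : ∀ u : Coord n, ofCoord e x u = ∑ i, u i • ofCoord e x (coordVec i) := by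
    intro u
    have hu : u = ∑ i, u i • (coordVec i : Coord n) := by
      ext k
      simp [coordVec, Pi.single_apply]
    let T : Coord n →L[ℝ] Coord n := mfderiv (𝓡 n) (𝓡 n) e.symm x
    have h1 : T u = ∑ i, u i • T (coordVec i) := by
      conv_lhs => rw [hu]
      simp only [map_sum, map_smul]
    exact h1
  rw [h v, h w]
  simp only [map_sum, map_smul, sum_apply, smul_apply,
    smul_eq_mul, Finset.mul_sum, metricMatrix, Matrix.of_apply]
  rw [Finset.sum_comm]
  exact Finset.sum_congr rfl fun i _ => Finset.sum_congr rfl fun j _ => by ring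

end Charts

/-! ### Geodesics, parallel fields and the infinitesimal form of preservation -/

section ParallelTransport

variable {n : ℕ} {M : Type*} [TopologicalSpace M] [ChartedSpace (Coord n) M]
  {L : TangentBundle (𝓡 n) M → ℝ} {e : OpenPartialHomeomorph M (Coord n)} {x v : Coord n}

lemma _root_.HasDerivAt.coord {V : ℝ → Coord n} {V' : Coord n} {t : ℝ} (h : HasDerivAt V V' t)
    (i : Fin n) : HasDerivAt (fun s => V s i) (V' i) t :=
  (EuclideanSpace.proj i : Coord n →L[ℝ] ℝ).hasFDerivAt.comp_hasDerivAt t h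

/-- The right-hand side of the equation of parallel transport in the coordinates of `e`. -/
def parallelField (L : TangentBundle (𝓡 n) M → ℝ) (e : OpenPartialHomeomorph M (Coord n))
    (x v w : Coord n) : Coord n :=
  WithLp.toLp 2 fun i => -∑ j, ∑ k, chernSymbol L e x v i j k * v j * w k

variable [IsManifold (𝓡 n) ∞ M]

lemma contDiffAt_parallelField (hL : IsLorentzFinsler L) (he : IsChart e) {Z : Type*}
    [NormedAddCommGroup Z] [NormedSpace ℝ Z] {a b c : Z → Coord n} {z : Z}
    (ha : ContDiffAt ℝ 1 a z) (hb : ContDiffAt ℝ 1 b z) (hc : ContDiffAt ℝ 1 c z)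
    (hz : (a z, b z) ∈ slitDomain e) :
    ContDiffAt ℝ 1 (fun y => parallelField L e (a y) (b y) (c y)) z := by
  have hs := contDiffOn_chartLagrangian hL he
  have hcoord : ∀ {f : Z → Coord n}, ContDiffAt ℝ 1 f z → ∀ i, ContDiffAt ℝ 1 (fun y => f y i) z :=
    fun hf i => contDiffAt_euclidean.1 hf i
  refine contDiffAt_euclidean.2 fun i => ?_
  refine ContDiffAt.neg (ContDiffAt.sum fun j _ => ContDiffAt.sum fun k _ =>
    (ContDiffAt.mul ?_ (hcoord hb j)).mul (hcoord hc k))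
  exact ContDiffAt.comp (f := fun y => (a y, b y)) z
    (((contDiffOn_chernSymbol hs hL he i j k).contDiffAt
      (isOpen_slitDomain.mem_nhds hz)).of_le (by simp)) (ha.prodMk hb)

/-- Local existence of geodesics, together with two parallel fields along them. -/
lemma exists_geodesic_parallel (hL : IsLorentzFinsler L) (he : IsChart e)
    (hp : (x, v) ∈ slitDomain e) (w₁ w₂ : Coord n) :
    ∃ ε > (0 : ℝ), ∃ X Y V W : ℝ → Coord n, X 0 = x ∧ Y 0 = v ∧ V 0 = w₁ ∧ W 0 = w₂ ∧
      ∀ t ∈ Set.Ioo (-ε) ε, (X t, Y t) ∈ slitDomain e ∧ HasDerivAt X (Y t) t ∧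
        HasDerivAt Y (parallelField L e (X t) (Y t) (Y t)) t ∧
        HasDerivAt V (parallelField L e (X t) (Y t) (V t)) t ∧
        HasDerivAt W (parallelField L e (X t) (Y t) (W t)) t := by
  -- Position, velocity and both parallel fields form one autonomous first-order system, so that a
  -- single application of Picard-Lindelöf gives them a common interval.
  let Φ : Coord n × Coord n × Coord n × Coord n → Coord n × Coord n × Coord n × Coord n :=
    fun z => (z.2.1, parallelField L e z.1 z.2.1 z.2.1, parallelField L e z.1 z.2.1 z.2.2.1,
      parallelField L e z.1 z.2.1 z.2.2.2)
  have hΦ : ContDiffAt ℝ 1 Φ (x, v, w₁, w₂) := by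
    have h1 : ContDiffAt ℝ 1 (fun z : Coord n × Coord n × Coord n × Coord n => z.1)
        (x, v, w₁, w₂) := by fun_prop
    have h2 : ContDiffAt ℝ 1 (fun z : Coord n × Coord n × Coord n × Coord n => z.2.1)
        (x, v, w₁, w₂) := by fun_prop
    have h3 : ContDiffAt ℝ 1 (fun z : Coord n × Coord n × Coord n × Coord n => z.2.2.1)
        (x, v, w₁, w₂) := by fun_prop
    have h4 : ContDiffAt ℝ 1 (fun z : Coord n × Coord n × Coord n × Coord n => z.2.2.2)
        (x, v, w₁, w₂) := by fun_prop
    exact h2.prodMk ((contDiffAt_parallelField hL he h1 h2 h2 hp).prodMk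
      ((contDiffAt_parallelField hL he h1 h2 h3 hp).prodMk
        (contDiffAt_parallelField hL he h1 h2 h4 hp)))
  obtain ⟨α, hα0, ε, hε, hα⟩ :=
    hΦ.exists_forall_mem_closedBall_exists_eq_forall_mem_Ioo_hasDerivAt₀ 0
  have hc : ContinuousAt (fun t => ((α t).1, (α t).2.1)) 0 := by
    have := (hα 0 (by constructor <;> linarith)).continuousAt
    exact this.fst.prodMk this.snd.fst
  -- By continuity the solution stays in the chart with non-zero velocity on a smaller interval.
  have hev : ∀ᶠ t in 𝓝 (0 : ℝ), ((α t).1, (α t).2.1) ∈ slitDomain e :=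
    hc.eventually_mem (isOpen_slitDomain.mem_nhds (by simpa only [hα0] using hp))
  obtain ⟨δ, hδ, hball⟩ := Metric.eventually_nhds_iff.1 hev
  refine ⟨min ε δ, lt_min hε hδ, fun t => (α t).1, fun t => (α t).2.1, fun t => (α t).2.2.1,
    fun t => (α t).2.2.2, congrArg (fun z => z.1) hα0,
    congrArg (fun z => z.2.1) hα0, congrArg (fun z => z.2.2.1) hα0,
    congrArg (fun z => z.2.2.2) hα0, fun t ht => ?_⟩
  have ht1 : t ∈ Set.Ioo (0 - ε) (0 + ε) := by
    have := min_le_left ε δ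
    exact ⟨by linarith [ht.1], by linarith [ht.2]⟩
  have ht2 : dist t 0 < δ := by
    have := min_le_right ε δ
    rw [Real.dist_eq, sub_zero, abs_lt]
    exact ⟨by linarith [ht.1], by linarith [ht.2]⟩
  have hd := hα t ht1
  exact ⟨hball ht2, hd.fst, hd.snd.fst, hd.snd.snd.fst, hd.snd.snd.snd⟩

section Curve

variable {J : Set ℝ} {X Y : ℝ → Coord n}

omit [IsManifold (𝓡 n) ∞ M] in
lemma velocity_symm_comp (he : IsChart e) (hJ : IsOpen J) {t : ℝ} (ht : t ∈ J)
    (hX : X t ∈ e.target) (hY : HasDerivAt X (Y t) t) :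
    velocity (n := n) J (fun s => e.symm (X s)) t = ofCoord e (X t) (Y t) := by
  have h1 : HasMFDerivAt (𝓡 n) (𝓡 n) e.symm (X t) (mfderiv (𝓡 n) (𝓡 n) e.symm (X t)) :=
    (he.mdifferentiable.mdifferentiableAt_symm hX).hasMFDerivAt
  have h2 := h1.comp t hY.hasFDerivAt.hasMFDerivAt
  have h3 : mfderiv 𝓘(ℝ, ℝ) (𝓡 n) (fun s => e.symm (X s)) t = _ := h2.mfderiv
  rw [velocity, mfderivWithin_of_isOpen hJ ht, h3]
  change mfderiv (𝓡 n) (𝓡 n) e.symm (X t) (ContinuousLinearMap.toSpanSingleton ℝ (Y t) 1) = _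
  rw [ContinuousLinearMap.toSpanSingleton_apply, one_smul]
  rfl

omit [IsManifold (𝓡 n) ∞ M] in
-- The field U need only agree with the coordinate expression on J. This lets the lemma apply also
-- to the velocity field, where it yields the geodesic equation.
lemma isParallelAlong_symm_comp (he : IsChart e) (hJ : IsOpen J)
    (hX : ∀ t ∈ J, (X t, Y t) ∈ slitDomain e) (hY : ∀ t ∈ J, HasDerivAt X (Y t) t)
    {V : ℝ → Coord n} (hV : ∀ t ∈ J, HasDerivAt V (parallelField L e (X t) (Y t) (V t)) t)
    {U : (t : ℝ) → TangentSpace (𝓡 n) (e.symm (X t))}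
    (hU : ∀ t ∈ J, U t = ofCoord e (X t) (V t)) :
    IsParallelAlong (chernSymbol L) J (fun t => e.symm (X t)) U := by
  intro t ht
  have hcoord : ∀ s ∈ J, toCoord e (e.symm (X s)) (U s) = V s := fun s hs => by
    rw [hU s hs, toCoord_ofCoord he (hX s hs).1]
  have hev : (fun s => toCoord e (e.symm (X s)) (U s)) =ᶠ[𝓝 t] V :=
    Filter.eventuallyEq_of_mem (hJ.mem_nhds ht) hcoord
  refine ⟨e, he, e.map_target (hX t ht).1, ?_, fun i => ?_⟩
  · exact ((hV t ht).differentiableAt.congr_of_eventuallyEq hev).differentiableWithinAt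
  · have hd : HasDerivAt (fun s => toCoord e (e.symm (X s)) (U s) i)
        (parallelField L e (X t) (Y t) (V t) i) t :=
      ((hV t ht).coord i).congr_of_eventuallyEq
        (hev.mono fun s hs => congrArg (fun u : Coord n => u i) hs)
    have hvel : toCoord e (e.symm (X t)) (velocity (n := n) J (fun s => e.symm (X s)) t) = Y t := by
      rw [velocity_symm_comp he hJ ht (hX t ht).1 (hY t ht), toCoord_ofCoord he (hX t ht).1]
    rw [covDerivAlong, derivWithin_of_isOpen hJ ht, hd.deriv, hvel, hcoord t ht,
      e.right_inv (hX t ht).1]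
    exact neg_add_cancel _

lemma isFinslerGeodesic_symm_comp (he : IsChart e) (hJ : IsOpen J)
    (hX : ∀ t ∈ J, (X t, Y t) ∈ slitDomain e) (hY : ∀ t ∈ J, HasDerivAt X (Y t) t)
    (hY' : ∀ t ∈ J, HasDerivAt Y (parallelField L e (X t) (Y t) (Y t)) t)
    (hL : IsLorentzFinsler L) :
    IsFinslerGeodesic L J (fun t => e.symm (X t)) := by
  refine ⟨?_, isParallelAlong_symm_comp he hJ hX hY hY' fun t ht =>
    velocity_symm_comp he hJ ht (hX t ht).1 (hY t ht)⟩
  have hXc : ContinuousOn X J := fun t ht => (hY t ht).continuousAt.continuousWithinAt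
  have hYc : ContinuousOn Y J := fun t ht => (hY' t ht).continuousAt.continuousWithinAt
  have hY1 : ContDiffOn ℝ 1 Y J := by
    refine (contDiffOn_succ_iff_deriv_of_isOpen (n := 0) hJ).2
      ⟨fun t ht => (hY' t ht).differentiableAt.differentiableWithinAt, by simp, ?_⟩
    -- Y' is continuous because the right-hand side of the geodesic equation is; hence Y is C¹ and X
    -- is C².
    refine contDiffOn_zero.2 (ContinuousOn.congr (fun t ht => ?_) fun t ht => (hY' t ht).deriv)
    have h := (contDiffAt_parallelField hL he (a := Prod.fst) (b := Prod.snd) (c := Prod.snd)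
      (z := (X t, Y t)) contDiffAt_fst contDiffAt_snd contDiffAt_snd (hX t ht)).continuousAt
    exact ContinuousAt.comp_continuousWithinAt (f := fun t => (X t, Y t)) h
      ((hXc t ht).prodMk (hYc t ht))
  have hX2 : ContDiffOn ℝ 2 X J :=
    (contDiffOn_succ_iff_deriv_of_isOpen (n := 1) hJ).2
      ⟨fun t ht => (hY t ht).differentiableAt.differentiableWithinAt, by simp,
        hY1.congr fun t ht => (hY t ht).deriv⟩
  exact ((contMDiffOn_symm_of_mem_maximalAtlas he).of_le (by norm_cast)).comp hX2.contMDiffOn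
    fun t ht => (hX t ht).1

end Curve

lemma fderiv_apply_eq_sum (f : Coord n → ℝ) (x v : Coord n) :
    fderiv ℝ f x v = ∑ l, v l * partialDeriv l f x := by
  have hv : v = ∑ l, v l • (coordVec l : Coord n) := by
    ext k
    simp [coordVec, Pi.single_apply]
  conv_lhs => rw [hv]
  simp only [map_sum, map_smul, smul_eq_mul, partialDeriv]

/-- Parallel transport contracts v with the first lower index of Γ, whereas the formula for N
contracts the second; the symmetry of Γ reconciles them. -/
lemma parallelField_coordVec (hL : IsLorentzFinsler L) (he : IsChart e)
    (hp : (x, v) ∈ slitDomain e) (i j : Fin n) :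
    parallelField L e x v (coordVec j) i = -sprayConn (chartSpray L e) i j (x, v) := by
  have hs := contDiffOn_chartLagrangian hL he
  rw [← sum_chernSymbol_mul hs hL he hp]
  simp only [parallelField]
  congr 1
  refine Finset.sum_congr rfl fun a _ => ?_
  rw [chernSymbol_symm hs hL he hp i j a]
  simp [coordVec]

/-- A metric preserved by parallel transport is preserved by the non-linear connection. -/
lemma sum_mul_partialDeriv_metricMatrix (hL : IsLorentzFinsler L) (he : IsChart e)
    {g : (x : M) → TangentSpace (𝓡 n) x →L[ℝ] TangentSpace (𝓡 n) x →L[ℝ] ℝ}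
    (hg : IsLorentzMetric g) (hpres : PreservedByParallelTransport L g)
    (hp : (x, v) ∈ slitDomain e) (j k : Fin n) :
    ∑ l, v l * partialDeriv l (fun y => metricMatrix g e y j k) x =
      ∑ a, (metricMatrix g e x a k * sprayConn (chartSpray L e) a j (x, v)
        + metricMatrix g e x j a * sprayConn (chartSpray L e) a k (x, v)) := by
  obtain ⟨ε, hε, X, Y, V, W, hX0, hY0, hV0, hW0, h⟩ :=
    exists_geodesic_parallel hL he hp (coordVec j) (coordVec k)
  have hJ : IsOpen (Set.Ioo (-ε) ε) := isOpen_Ioo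
  have h0 : (0 : ℝ) ∈ Set.Ioo (-ε) ε := ⟨by linarith, hε⟩
  have hX : ∀ t ∈ Set.Ioo (-ε) ε, (X t, Y t) ∈ slitDomain e := fun t ht => (h t ht).1
  have hY : ∀ t ∈ Set.Ioo (-ε) ε, HasDerivAt X (Y t) t := fun t ht => (h t ht).2.1
  have hconst : ∀ t ∈ Set.Ioo (-ε) ε, ∑ a, ∑ b, metricMatrix g e (X t) a b * V t a * W t b =
      ∑ a, ∑ b, metricMatrix g e (X 0) a b * V 0 a * W 0 b := by
    intro t ht
    rw [← apply_ofCoord, ← apply_ofCoord]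
    exact hpres (Set.Ioo (-ε) ε) (fun t => e.symm (X t)) Set.ordConnected_Ioo
      ⟨0, h0, ε / 2, ⟨by linarith, by linarith⟩, by linarith⟩
      (isFinslerGeodesic_symm_comp he hJ hX hY (fun t ht => (h t ht).2.2.1) hL)
      (fun s hs => by
        rw [velocity_symm_comp he hJ hs (hX s hs).1 (hY s hs)]
        exact ofCoord_ne_zero he (hX s hs).1 (hX s hs).2)
      (fun t => ofCoord e (X t) (V t)) (fun t => ofCoord e (X t) (W t))
      (isParallelAlong_symm_comp he hJ hX hY (fun t ht => (h t ht).2.2.2.1) fun _ _ => rfl)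
      (isParallelAlong_symm_comp he hJ hX hY (fun t ht => (h t ht).2.2.2.2) fun _ _ => rfl)
      t ht 0 h0
  obtain ⟨-, hdX, -, hdV, hdW⟩ := h 0 h0
  have hdm : ∀ a b, HasDerivAt (fun t => metricMatrix g e (X t) a b)
      (∑ l, v l * partialDeriv l (fun y => metricMatrix g e y a b) x) 0 := by
    intro a b
    rw [← fderiv_apply_eq_sum]
    have hm := (differentiableAt_of_contDiffOn e.open_target
      (contDiffOn_metricMatrix hg he a b) hp.1).hasFDerivAt
    rw [← hY0]
    refine HasFDerivAt.comp_hasDerivAt (l := fun y => metricMatrix g e y a b) (0 : ℝ) ?_ hdX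
    rw [hX0]
    exact hm
  have hd : HasDerivAt (fun t => ∑ a, ∑ b, metricMatrix g e (X t) a b * V t a * W t b) _ 0 :=
    HasDerivAt.fun_sum fun a _ => HasDerivAt.fun_sum fun b _ =>
      ((hdm a b).mul (hdV.coord a)).mul (hdW.coord b)
  -- The product-rule derivative of g(V, W) at time 0 is zero by constancy. Inserting the initial
  -- values e_j and e_k reduces the double sum to the claim.
  have hz := hd.unique ((hasDerivAt_const (0 : ℝ) _).congr_of_eventuallyEq
    (Filter.eventuallyEq_of_mem (hJ.mem_nhds h0) hconst))
  simp only [Pi.mul_apply] at hz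
  rw [hX0, hY0, hV0, hW0] at hz
  simp only [parallelField_coordVec hL he hp] at hz
  have hc : ∀ a b : Fin n, (coordVec a : Coord n) b = if b = a then 1 else 0 := fun a b => by
    simp [coordVec]
  simp only [hc, Finset.sum_add_distrib, mul_ite, mul_one, mul_zero, ite_mul, zero_mul,
    Finset.sum_ite_eq', Finset.mem_univ, if_true, mul_neg, Finset.sum_neg_distrib,
    Finset.sum_ite_irrel, Finset.sum_const_zero] at hz
  rw [Finset.sum_add_distrib]
  linarith

end ParallelTransport

/-! ### Equality of the connections and of their geodesics -/

section Main

variable {n : ℕ} {M : Type*} [TopologicalSpace M] [ChartedSpace (Coord n) M]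

/-- Geodesics only depend on the connection coefficients at non-zero reference vectors. -/
lemma IsGeodesic.congr
    {Γ Γ' : OpenPartialHomeomorph M (Coord n) → Coord n → Coord n → Fin n → Fin n → Fin n → ℝ}
    (hΓ : ∀ e : OpenPartialHomeomorph M (Coord n), IsChart e → ∀ x ∈ e.target, ∀ v : Coord n,
      v ≠ 0 → ∀ i j k, Γ e x v i j k = Γ' e x v i j k)
    {J : Set ℝ} {η : ℝ → M} (h : IsGeodesic Γ J η) : IsGeodesic Γ' J η := by
  refine ⟨h.1, fun t ht => ?_⟩
  obtain ⟨e, he, hs, hd, hz⟩ := h.2 t ht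
  refine ⟨e, he, hs, hd, fun i => ?_⟩
  rw [← hz i, covDerivAlong, covDerivAlong]
  congr 1
  refine Finset.sum_congr rfl fun j _ => Finset.sum_congr rfl fun k _ => ?_
  -- At zero velocity the factor η'^j annihilates the connection term, whatever value the
  -- coefficients take there.
  by_cases h0 : toCoord e (η t) (velocity J η t) = 0
  · simp [h0]
  · rw [hΓ e he _ (e.map_source hs) _ h0]

variable [IsManifold (𝓡 n) ∞ M] {L : TangentBundle (𝓡 n) M → ℝ}
  {g : (x : M) → TangentSpace (𝓡 n) x →L[ℝ] TangentSpace (𝓡 n) x →L[ℝ] ℝ}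

/-- The Chern connection of `L` is the Levi-Civita connection of every Lorentzian metric that is
preserved by parallel transport. -/
lemma chernSymbol_eq_leviCivitaSymbol (hL : IsLorentzFinsler L) (hg : IsLorentzMetric g)
    (hpres : PreservedByParallelTransport L g) {e : OpenPartialHomeomorph M (Coord n)}
    (he : IsChart e) {x v : Coord n} (hx : x ∈ e.target) (hv : v ≠ 0) (i j k : Fin n) :
    chernSymbol L e x v i j k = leviCivitaSymbol g e x i j k :=
  chernSymbol_eq_christoffel (contDiffOn_chartLagrangian hL he) hL he hx
    (fun y hy => (hg.lorentzian e he y hy).isSymm) (hg.lorentzian e he x hx).isUnit_det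
    (fun _ hu j k => sum_mul_partialDeriv_metricMatrix hL he hg hpres ⟨hx, hu⟩ j k) hv i j k

end Main

end LorentzFinsler

end

open LorentzFinsler in
theorem proposition5p2 {n : ℕ} (hn : 2 ≤ n) {M : Type*} [TopologicalSpace M] [ConnectedSpace M]
    [ChartedSpace (Coord n) M] [IsManifold (𝓡 n) ∞ M]
    (L : TangentBundle (𝓡 n) M → ℝ) (hL : IsFinslerSpacetime L)
    (g : (x : M) → TangentSpace (𝓡 n) x →L[ℝ] TangentSpace (𝓡 n) x →L[ℝ] ℝ)
    (hg : IsLorentzMetric g) (hpres : PreservedByParallelTransport L g) :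
    (∀ (J : Set ℝ) (η : ℝ → M), J.OrdConnected → J.Nontrivial →
      (IsFinslerGeodesic L J η ↔ IsMetricGeodesic g J η)) ∧
    (∀ e : OpenPartialHomeomorph M (Coord n), IsChart e → ∀ x ∈ e.target,
      ∀ v : Coord n, v ≠ 0 → ∀ i j k : Fin n,
        chernSymbol L e x v i j k = leviCivitaSymbol g e x i j k) ∧
    IsBerwald L := by
  have h : ∀ e : OpenPartialHomeomorph M (Coord n), IsChart e → ∀ x ∈ e.target,
      ∀ v : Coord n, v ≠ 0 → ∀ i j k : Fin n,
        chernSymbol L e x v i j k = leviCivitaSymbol g e x i j k :=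
    fun e he x hx v hv i j k =>
      chernSymbol_eq_leviCivitaSymbol hL.toIsLorentzFinsler hg hpres he hx hv i j k
  refine ⟨fun J η _ _ => ⟨fun hη => IsGeodesic.congr h hη, fun hη => IsGeodesic.congr
    (fun e he x hx v hv i j k => (h e he x hx v hv i j k).symm) hη⟩, h, ?_⟩
  intro e he x hx v w hv hw i j k
  rw [h e he x hx v hv, h e he x hx w hw]
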